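/- Let $k$ be an algebraically closed field. A $k$-scheme is a separated scheme of finite type over $k$; a fat point over $k$ is a finite $k$-scheme $\mathfrak z=\operatorname{Spec}R$ with exactly one point, and its length $\ell(\mathfrak z)$ is the length of $R$. An arc scheme of a $k$-scheme $X$ along $\mathfrak z$ is a $k$-scheme $\nabla_{\mathfrak z}X$ with a morphism $\mathfrak z\times_k\nabla_{\mathfrak z}X\to X$ such that, for every $k$-scheme $T$, composition with it is a bijection from the $k$-morphisms $T\to\nabla_{\mathfrak z}X$ to the $k$-morphisms $\mathfrak z\times_kT\to X$; in particular its $\mathfrak w$-rational points are the $\mathfrak z\times_k\mathfrak w$-rational points of $X$, for every fat point $\mathfrak w$. A morphism $\bar{\mathfrak z}\to\mathfrak z$ of fat points induces, by restriction of arcs, a canonical map $\nabla_{\mathfrak z}X\to\nabla_{\bar{\mathfrak z}}X$. A morphism $f\colon Y\to X$ of $k$-schemes is a locally trivial fibration with fiber $Z$ if every point of $X$ has an open neighborhood $U$ over which $f$ is isomorphic to the projection $U\times_kZ\to U$. A sieve on a $k$-scheme $X$ is a sub-presheaf of the presheaf $\mathfrak w\mapsto X(\mathfrak w)=\operatorname{Mor}_k(\mathfrak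 w,X)$ on the category of fat points over $k$; it is sub-Zariski if it is the image of $Y(\cdot)\to X(\cdot)$ for some morphism $Y\to X$ of $k$-schemes. The sub-Zariski Grothendieck ring is the free abelian group on all sub-Zariski sieves on all $k$-schemes, modulo the relations $\langle F\rangle=\langle G\rangle$ if $F\cong G$, and $\langle F\rangle+\langle G\rangle=\langle F\cup G\rangle+\langle F\cap G\rangle$ for $F,G$ on a common $k$-scheme, with multiplication induced by the product of sieves. Write $[X]$ for the class of the presheaf $X(\cdot)$, and $\mathbb L=[\mathbb A^1_k]$. Here $\cong$ means either natural isomorphism, or natural isomorphism that is explicit in both directions; a natural transformation $s\colon F\to G$ between sieves on $X$ and $Y$ is explicit if it is the restriction of a morphism of schemes $X'\to Y$, where $X'\subseteq X$ is a locally closed subscheme containing all points in $F$. Let $X$ be a $k$-scheme that is smooth over $k$ of pure dimension $d$. Then: (1) $X$ has an arc scheme $\nabla_{\mathfrak z}X$ along every fat point $\mathfrak z$ over $k$. (2) For every closed immersion $\bar{\mathfrak z}\to\mathfrak z$ of fat points over $k$, of lengths $\bar l\le l$, the canonical map $\nabla_{\mathfrak z}X\to\nabla_{\bar{\mathfrak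 z}}X$ is a locally trivial fibration with fiber the affine space $\mathbb A_k^{d(l-\bar l)}$. (3) For every fat point $\mathfrak z$ of length $l$, $$[\nabla_{\mathfrak z}X]=[X]\cdot\mathbb L^{d(l-1)}$$ in the sub-Zariski Grothendieck ring, for both readings of $\cong$. -/

import Mathlib

open CategoryTheory CategoryTheory.Limits AlgebraicGeometry Opposite

universe u

noncomputable section

namespace FatArc

variable (k : Type u) [Field k]

/-! ### Schemes and fat points over a field -/

/-- The objects over `Spec k` that are separated and of finite type. -/
def isKScheme : ObjectProperty (Over (Spec (.of k))) := fun X =>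
  IsSeparated X.hom ∧ LocallyOfFiniteType X.hom ∧ QuasiCompact X.hom

/-- The category of `k`-schemes: separated schemes of finite type over `k`, with morphisms
over `k`. -/
abbrev KScheme : Type (u + 1) := (isKScheme k).FullSubcategory

variable {k}

namespace KScheme

/-- The underlying scheme. -/
abbrev toScheme (X : KScheme k) : Scheme.{u} := X.obj.left

/-- The structure morphism. -/
abbrev str (X : KScheme k) : X.toScheme ⟶ Spec (.of k) := X.obj.hom

/-- The underlying morphism of schemes. -/
abbrev mor {X Y : KScheme k} (f : X ⟶ Y) : X.toScheme ⟶ Y.toScheme := f.hom.left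

instance (X : KScheme k) : IsSeparated X.str := X.property.1
instance (X : KScheme k) : LocallyOfFiniteType X.str := X.property.2.1
instance (X : KScheme k) : QuasiCompact X.str := X.property.2.2

lemma mor_str {X Y : KScheme k} (f : X ⟶ Y) : mor f ≫ Y.str = X.str := Over.w f.hom

lemma mor_ext {X Y : KScheme k} {f g : X ⟶ Y} (h : mor f = mor g) : f = g :=
  ObjectProperty.hom_ext _ (Over.OverMorphism.ext h)

/-- A `k`-scheme from a morphism to `Spec k`. -/
abbrev mk {S : Scheme.{u}} (f : S ⟶ Spec (.of k)) [IsSeparated f] [LocallyOfFiniteType f]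
    [QuasiCompact f] : KScheme k :=
  ⟨Over.mk f, inferInstanceAs (IsSeparated f), inferInstanceAs (LocallyOfFiniteType f),
    inferInstanceAs (QuasiCompact f)⟩

/-- A morphism of `k`-schemes from a morphism of schemes over `Spec k`. -/
abbrev homMk {X Y : KScheme k} (f : X.toScheme ⟶ Y.toScheme) (h : f ≫ Y.str = X.str) : X ⟶ Y :=
  ObjectProperty.homMk (Over.homMk f h)

variable (k) in
/-- The point `Spec k`. -/
def pt : KScheme k := mk (𝟙 (Spec (.of k)))

/-- The structure morphism, as a morphism of `k`-schemes. -/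
def toPt (X : KScheme k) : X ⟶ pt k := homMk X.str (Category.comp_id _)

lemma toPt_unique {X : KScheme k} (f g : X ⟶ pt k) : f = g := by
  apply mor_ext
  have hf := mor_str f
  have hg := mor_str g
  have h1 : (pt k).str = 𝟙 _ := rfl
  rw [h1] at hf hg
  exact ((Category.comp_id _).symm.trans hf).trans ((Category.comp_id _).symm.trans hg).symm

/-- The product over `k`. -/
def prod (X Y : KScheme k) : KScheme k := mk (pullback.fst X.str Y.str ≫ X.str)

/-- The first projection. -/
def fst (X Y : KScheme k) : X.prod Y ⟶ X := homMk (pullback.fst X.str Y.str) rfl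

/-- The second projection. -/
def snd (X Y : KScheme k) : X.prod Y ⟶ Y :=
  homMk (pullback.snd X.str Y.str) pullback.condition.symm

/-- The morphism to a product with given components. -/
def lift {T X Y : KScheme k} (a : T ⟶ X) (b : T ⟶ Y) : T ⟶ X.prod Y :=
  homMk (pullback.lift (mor a) (mor b) ((mor_str a).trans (mor_str b).symm)) (by
    change pullback.lift _ _ _ ≫ pullback.fst _ _ ≫ _ = _
    rw [pullback.lift_fst_assoc]
    exact mor_str a)

@[simp]
lemma lift_fst {T X Y : KScheme k} (a : T ⟶ X) (b : T ⟶ Y) : lift a b ≫ fst X Y = a :=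
  mor_ext (pullback.lift_fst _ _ _)

@[simp]
lemma lift_fst_assoc {T X Y Z : KScheme k} (a : T ⟶ X) (b : T ⟶ Y) (h : X ⟶ Z) :
    lift a b ≫ fst X Y ≫ h = a ≫ h := by
  rw [← Category.assoc, lift_fst]

@[simp]
lemma lift_snd {T X Y : KScheme k} (a : T ⟶ X) (b : T ⟶ Y) : lift a b ≫ snd X Y = b :=
  mor_ext (pullback.lift_snd _ _ _)

@[simp]
lemma lift_snd_assoc {T X Y Z : KScheme k} (a : T ⟶ X) (b : T ⟶ Y) (h : Y ⟶ Z) :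
    lift a b ≫ snd X Y ≫ h = b ≫ h := by
  rw [← Category.assoc, lift_snd]

lemma prod_ext {T X Y : KScheme k} {f g : T ⟶ X.prod Y} (h₁ : f ≫ fst X Y = g ≫ fst X Y)
    (h₂ : f ≫ snd X Y = g ≫ snd X Y) : f = g :=
  mor_ext (pullback.hom_ext (congrArg mor h₁) (congrArg mor h₂))

/-- The product of two morphisms. -/
def map {X X' Y Y' : KScheme k} (f : X ⟶ X') (g : Y ⟶ Y') : X.prod Y ⟶ X'.prod Y' :=
  lift (fst X Y ≫ f) (snd X Y ≫ g)

@[simp]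
lemma map_fst {X X' Y Y' : KScheme k} (f : X ⟶ X') (g : Y ⟶ Y') :
    map f g ≫ fst X' Y' = fst X Y ≫ f := lift_fst _ _

@[simp]
lemma map_fst_assoc {X X' Y Y' Z : KScheme k} (f : X ⟶ X') (g : Y ⟶ Y') (h : X' ⟶ Z) :
    map f g ≫ fst X' Y' ≫ h = fst X Y ≫ f ≫ h := lift_fst_assoc _ _ _ |>.trans (by simp)

@[simp]
lemma map_snd {X X' Y Y' : KScheme k} (f : X ⟶ X') (g : Y ⟶ Y') :
    map f g ≫ snd X' Y' = snd X Y ≫ g := lift_snd _ _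

@[simp]
lemma map_snd_assoc {X X' Y Y' Z : KScheme k} (f : X ⟶ X') (g : Y ⟶ Y') (h : Y' ⟶ Z) :
    map f g ≫ snd X' Y' ≫ h = snd X Y ≫ g ≫ h := lift_snd_assoc _ _ _ |>.trans (by simp)

lemma lift_map {T X X' Y Y' : KScheme k} (a : T ⟶ X) (b : T ⟶ Y) (f : X ⟶ X') (g : Y ⟶ Y') :
    lift a b ≫ map f g = lift (a ≫ f) (b ≫ g) := by
  apply prod_ext <;> simp

variable (k) in
/-- Affine space of dimension `n` over `k`. -/
def affineSpace (n : ℕ) : KScheme k := mk (𝔸(ULift.{u} (Fin n); Spec (.of k)) ↘ Spec (.of k))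

end KScheme

variable (k) in
/-- Finite schemes over `k` with exactly one point. -/
def isFatPoint : ObjectProperty (KScheme k) := fun z =>
  IsFinite z.str ∧ Nonempty (Unique z.toScheme)

variable (k) in
/-- The category of fat points over `k`. -/
abbrev FatPoint : Type (u + 1) := (isFatPoint k).FullSubcategory

/-- The length of a fat point: the length of its coordinate ring as a module over itself. -/
def FatPoint.length (z : FatPoint k) : ℕ :=
  (Module.length Γ(z.obj.toScheme, ⊤) Γ(z.obj.toScheme, ⊤)).toNat

open KScheme

/-! ### Arc schemes -/

/-- An arc scheme of the `k`-scheme `X` along the fat point `z`: a `k`-scheme `A` together with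
a universal family `z × A ⟶ X` of maps from `z` to `X`, so that the maps `T ⟶ A` are in bijection
with the maps `z × T ⟶ X`. It is unique up to unique isomorphism. -/
structure ArcScheme (z : FatPoint k) (X : KScheme k) where
  /-- the underlying `k`-scheme -/
  carrier : KScheme k
  /-- the universal arc -/
  ev : z.obj.prod carrier ⟶ X
  bijective : ∀ T : KScheme k, Function.Bijective
    fun a : T ⟶ carrier => KScheme.map (𝟙 z.obj) a ≫ ev

/-- The morphism `T ⟶ A` to the arc scheme that classifies a family `z × T ⟶ X` of arcs. -/
def ArcScheme.classify {z : FatPoint k} {X : KScheme k} (A : ArcScheme z X) {T : KScheme k}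
    (b : z.obj.prod T ⟶ X) : T ⟶ A.carrier :=
  (Equiv.ofBijective _ (A.bijective T)).symm b

/-- The canonical map from the arc scheme along `z` to the arc scheme along `z'` induced by a
morphism `i : z' ⟶ z` of fat points: restriction of arcs along `i`. -/
def arcMap {z z' : FatPoint k} {X : KScheme k} (i : z' ⟶ z) (A : ArcScheme z X)
    (A' : ArcScheme z' X) : A.carrier ⟶ A'.carrier :=
  A'.classify (KScheme.map i.hom (𝟙 A.carrier) ≫ A.ev)

/-- `f : Y ⟶ X` is a locally trivial fibration with fiber `F`: every point of `X` has an open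
neighborhood `U` over which `f` is isomorphic to the projection `U × F ⟶ U`. -/
def IsLocallyTrivialFibration {Y X : KScheme k} (f : Y ⟶ X) (F : KScheme k) : Prop :=
  ∀ x : X.toScheme, ∃ U : X.toScheme.Opens, x ∈ U ∧
    ∃ e : (mor f ⁻¹ᵁ U).toScheme ≅ pullback (U.ι ≫ X.str) F.str,
      e.hom ≫ pullback.fst (U.ι ≫ X.str) F.str = mor f ∣_ U

/-! ### Sieves and sub-Zariski motives -/

/-- A sieve on `X`: a sub-presheaf of the presheaf on fat points that is represented by `X`. That
is, for every fat point `w` a set of `w`-rational points `w ⟶ X` on `X`, compatible with all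
morphisms of fat points. -/
@[ext]
structure Sieve (X : KScheme k) where
  /-- the set of `w`-rational points that belong to the sieve -/
  points : ∀ w : FatPoint k, Set (w.obj ⟶ X)
  comp_mem : ∀ {v w : FatPoint k} (f : v.obj ⟶ w.obj) {p : w.obj ⟶ X}, p ∈ points w →
    f ≫ p ∈ points v

namespace Sieve

/-- The sieve of all points of `X`, that is, the presheaf represented by `X`. -/
def all (X : KScheme k) : Sieve X where
  points _ := Set.univ
  comp_mem _ _ _ := trivial

/-- The union of two sieves on `X`. -/
def union {X : KScheme k} (F G : Sieve X) : Sieve X where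
  points w := F.points w ∪ G.points w
  comp_mem f _ h := h.imp (F.comp_mem f) (G.comp_mem f)

/-- The intersection of two sieves on `X`. -/
def inter {X : KScheme k} (F G : Sieve X) : Sieve X where
  points w := F.points w ∩ G.points w
  comp_mem f _ h := ⟨F.comp_mem f h.1, G.comp_mem f h.2⟩

/-- The image of a morphism `φ : Y ⟶ X`: the points of `X` that lift to `Y`. -/
def image {X Y : KScheme k} (φ : Y ⟶ X) : Sieve X where
  points _ := {p | ∃ q, q ≫ φ = p}
  comp_mem f p := by
    rintro ⟨q, rfl⟩
    exact ⟨f ≫ q, Category.assoc _ _ _⟩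

/-- A sieve is sub-Zariski if it is the image of a morphism of `k`-schemes. -/
def IsSubZariski {X : KScheme k} (F : Sieve X) : Prop :=
  ∃ (Y : KScheme k) (φ : Y ⟶ X), F = image φ

lemma isSubZariski_all (X : KScheme k) : (all X).IsSubZariski :=
  ⟨X, 𝟙 X, by
    ext w p
    exact ⟨fun _ => ⟨p, Category.comp_id _⟩, fun _ => trivial⟩⟩

/-- The product of two sieves: the pairs of points, as a sieve on the product of the ambient
spaces. -/
def prod {X Y : KScheme k} (F : Sieve X) (G : Sieve Y) : Sieve (X.prod Y) where
  points w := {p | p ≫ fst X Y ∈ F.points w ∧ p ≫ snd X Y ∈ G.points w}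
  comp_mem f p h := by
    simp only [Set.mem_ofPred_eq, Category.assoc] at h ⊢
    exact ⟨F.comp_mem f h.1, G.comp_mem f h.2⟩

lemma IsSubZariski.prod {X Y : KScheme k} {F : Sieve X} {G : Sieve Y} (hF : F.IsSubZariski)
    (hG : G.IsSubZariski) : (F.prod G).IsSubZariski := by
  obtain ⟨X', φ, rfl⟩ := hF
  obtain ⟨Y', ψ, rfl⟩ := hG
  refine ⟨X'.prod Y', KScheme.map φ ψ, ?_⟩
  ext w p
  constructor
  · rintro ⟨⟨a, ha⟩, ⟨b, hb⟩⟩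
    exact ⟨lift a b, by rw [lift_map]; apply prod_ext <;> simp [ha, hb]⟩
  · rintro ⟨c, rfl⟩
    exact ⟨⟨c ≫ fst _ _, by simp⟩, ⟨c ≫ snd _ _, by simp⟩⟩

/-- A morphism of sieves: a natural transformation of presheaves on fat points. -/
structure Mor {X Y : KScheme k} (F : Sieve X) (G : Sieve Y) where
  /-- the map on `w`-rational points -/
  app : ∀ w : FatPoint k, F.points w → G.points w
  naturality : ∀ {v w : FatPoint k} (f : v.obj ⟶ w.obj) (p : F.points w),
    (app v ⟨f ≫ p.1, F.comp_mem f p.2⟩).1 = f ≫ (app w p).1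

/-- A morphism of sieves `s : F ⟶ G` is explicit if it is induced by a morphism of schemes: there
are a locally closed subscheme `i : X' ⟶ X` on which `F` is still a sieve, that is, which contains
all points in `F`, and a morphism `φ : X' ⟶ Y` that restricts to `s`. -/
def Mor.IsExplicit {X Y : KScheme k} {F : Sieve X} {G : Sieve Y} (s : Mor F G) : Prop :=
  ∃ (X' : KScheme k) (i : X' ⟶ X) (φ : X' ⟶ Y), IsImmersion (mor i) ∧
    (∀ w, F.points w ⊆ (image i).points w) ∧
    ∀ (w : FatPoint k) (q : w.obj ⟶ X') (hq : q ≫ i ∈ F.points w),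
      (s.app w ⟨q ≫ i, hq⟩).1 = q ≫ φ

end Sieve

/-- The two variants of the category of sieves: with all morphisms (natural transformations), or
only with the explicit ones. -/
inductive Site
  /-- all morphisms -/
  | full
  /-- only the explicit morphisms -/
  | explicit

namespace Sieve

/-- Isomorphism of sieves in the given variant: mutually inverse natural transformations, which in
the explicit variant are moreover both required to be explicit. -/
def Isomorphic (S : Site) {X Y : KScheme k} (F : Sieve X) (G : Sieve Y) : Prop :=
  ∃ (s : Mor F G) (t : Mor G F), (∀ w p, t.app w (s.app w p) = p) ∧
    (∀ w p, s.app w (t.app w p) = p) ∧ (S = .explicit → s.IsExplicit ∧ t.IsExplicit)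

/-- The morphism of sieves induced by a morphism of the ambient spaces. -/
def Mor.ofHom {X Y : KScheme k} {F : Sieve X} {G : Sieve Y} (f : X ⟶ Y)
    (h : ∀ (w : FatPoint k) (p : w.obj ⟶ X), p ∈ F.points w → p ≫ f ∈ G.points w) : Mor F G where
  app w p := ⟨p.1 ≫ f, h w p.1 p.2⟩
  naturality _ _ := Category.assoc _ _ _

lemma Mor.isExplicit_ofHom {X Y : KScheme k} {F : Sieve X} {G : Sieve Y} (f : X ⟶ Y)
    (h : ∀ (w : FatPoint k) (p : w.obj ⟶ X), p ∈ F.points w → p ≫ f ∈ G.points w) :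
    (Mor.ofHom (F := F) (G := G) f h).IsExplicit :=
  ⟨X, 𝟙 X, f, inferInstanceAs (IsImmersion (𝟙 X.toScheme)),
    fun _ p _ => ⟨p, Category.comp_id _⟩, fun _ q _ => by simp [Mor.ofHom]⟩

lemma Isomorphic.of_ambient {S : Site} {X Y : KScheme k} {F : Sieve X} {G : Sieve Y} (f : X ⟶ Y)
    (g : Y ⟶ X) (hfg : f ≫ g = 𝟙 _) (hgf : g ≫ f = 𝟙 _)
    (hf : ∀ (w : FatPoint k) (p : w.obj ⟶ X), p ∈ F.points w → p ≫ f ∈ G.points w)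
    (hg : ∀ (w : FatPoint k) (p : w.obj ⟶ Y), p ∈ G.points w → p ≫ g ∈ F.points w) :
    Isomorphic S F G :=
  ⟨Mor.ofHom f hf, Mor.ofHom g hg, fun _ p => Subtype.ext (by simp [Mor.ofHom, hfg]),
    fun _ p => Subtype.ext (by simp [Mor.ofHom, hgf]),
    fun _ => ⟨Mor.isExplicit_ofHom f hf, Mor.isExplicit_ofHom g hg⟩⟩

lemma Isomorphic.refl (S : Site) {X : KScheme k} (F : Sieve X) : Isomorphic S F F :=
  .of_ambient (𝟙 _) (𝟙 _) (by simp) (by simp) (fun _ p hp => by simpa using hp)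
    (fun _ p hp => by simpa using hp)

/-- The product of two morphisms of sieves. -/
def Mor.prod {X X' Y Y' : KScheme k} {F : Sieve X} {F' : Sieve X'} {G : Sieve Y} {G' : Sieve Y'}
    (s : Mor F F') (t : Mor G G') : Mor (F.prod G) (F'.prod G') where
  app w p := ⟨lift (s.app w ⟨p.1 ≫ fst X Y, p.2.1⟩).1 (t.app w ⟨p.1 ≫ snd X Y, p.2.2⟩).1, by
    refine ⟨?_, ?_⟩
    · rw [lift_fst]; exact (s.app w _).2
    · rw [lift_snd]; exact (t.app w _).2⟩
  naturality f p := by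
    apply prod_ext
    · have h := s.naturality f ⟨p.1 ≫ fst X Y, p.2.1⟩
      simp only [Category.assoc, lift_fst]
      exact h
    · have h := t.naturality f ⟨p.1 ≫ snd X Y, p.2.2⟩
      simp only [Category.assoc, lift_snd]
      exact h

lemma isImmersion_map {X X' Y Y' : KScheme k} (i : X ⟶ X') (j : Y ⟶ Y')
    (hi : IsImmersion (mor i)) (hj : IsImmersion (mor j)) :
    IsImmersion (mor (KScheme.map i j)) := by
  have : MorphismProperty.IsMultiplicative @IsImmersion.{u} := inferInstance
  have : MorphismProperty.IsStableUnderComposition @IsImmersion.{u} :=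
    this.toIsStableUnderComposition
  have h := MorphismProperty.pullbackMap (P := @IsImmersion) (f := X.str) (g := Y.str)
    (f' := X'.str) (g' := Y'.str) hi hj (mor_str i).symm (mor_str j).symm
  have e : mor (KScheme.map i j) = pullback.map X.str Y.str X'.str Y'.str (mor i) (mor j) (𝟙 _)
      ((Category.comp_id _).trans (mor_str i).symm)
      ((Category.comp_id _).trans (mor_str j).symm) :=
    pullback.hom_ext ((congrArg mor (map_fst i j)).trans (pullback.lift_fst _ _ _).symm)
      ((congrArg mor (map_snd i j)).trans (pullback.lift_snd _ _ _).symm)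
  rw [e]
  exact h

lemma Mor.IsExplicit.prod {X X' Y Y' : KScheme k} {F : Sieve X} {F' : Sieve X'} {G : Sieve Y}
    {G' : Sieve Y'} {s : Mor F F'} {t : Mor G G'} (hs : s.IsExplicit) (ht : t.IsExplicit) :
    (s.prod t).IsExplicit := by
  obtain ⟨A, i, φ, hi, hF, hφ⟩ := hs
  obtain ⟨B, j, ψ, hj, hG, hψ⟩ := ht
  refine ⟨A.prod B, KScheme.map i j, KScheme.map φ ψ, isImmersion_map i j hi hj, ?_, ?_⟩
  · intro w p hp
    obtain ⟨a, ha⟩ := hF w hp.1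
    obtain ⟨b, hb⟩ := hG w hp.2
    exact ⟨lift a b, by rw [lift_map]; apply prod_ext <;> simp [ha, hb]⟩
  · intro w q hq
    have h1 := hφ w (q ≫ fst A B) (by simpa using hq.1)
    have h2 := hψ w (q ≫ snd A B) (by simpa using hq.2)
    simp only [Category.assoc] at h1 h2
    apply prod_ext
    · simpa [Mor.prod] using h1
    · simpa [Mor.prod] using h2

lemma Isomorphic.prod {S : Site} {X X' Y Y' : KScheme k} {F : Sieve X} {F' : Sieve X'}
    {G : Sieve Y} {G' : Sieve Y'} (h : Isomorphic S F F') (h' : Isomorphic S G G') :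
    Isomorphic S (F.prod G) (F'.prod G') := by
  obtain ⟨s, t, hst, hts, he⟩ := h
  obtain ⟨s', t', hst', hts', he'⟩ := h'
  refine ⟨s.prod s', t.prod t', fun w p => ?_, fun w p => ?_, fun hS =>
    ⟨(he hS).1.prod (he' hS).1, (he hS).2.prod (he' hS).2⟩⟩
  · apply Subtype.ext
    apply prod_ext <;> simp [Mor.prod, hst, hst']
  · apply Subtype.ext
    apply prod_ext <;> simp [Mor.prod, hts, hts']

lemma Isomorphic.prod_comm (S : Site) {X Y : KScheme k} (F : Sieve X) (G : Sieve Y) :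
    Isomorphic S (F.prod G) (G.prod F) := by
  refine .of_ambient (lift (snd _ _) (fst _ _)) (lift (snd _ _) (fst _ _)) ?_ ?_ ?_ ?_
  · apply prod_ext <;> simp
  · apply prod_ext <;> simp
  · exact fun w p hp => ⟨by simpa using hp.2, by simpa using hp.1⟩
  · exact fun w p hp => ⟨by simpa using hp.2, by simpa using hp.1⟩

lemma Isomorphic.prod_assoc (S : Site) {X Y Z : KScheme k} (F : Sieve X) (G : Sieve Y)
    (H : Sieve Z) : Isomorphic S ((F.prod G).prod H) (F.prod (G.prod H)) := by
  refine .of_ambient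
    (lift (fst _ _ ≫ fst _ _) (lift (fst _ _ ≫ snd _ _) (snd _ _)))
    (lift (lift (fst _ _) (snd _ _ ≫ fst _ _)) (snd _ _ ≫ snd _ _)) ?_ ?_ ?_ ?_
  · apply prod_ext
    · apply prod_ext <;> simp
    · simp
  · apply prod_ext
    · simp
    · apply prod_ext <;> simp
  · exact fun w p hp =>
      ⟨by simpa using hp.1.1, by simpa using hp.1.2, by simpa using hp.2⟩
  · exact fun w p hp =>
      ⟨⟨by simpa using hp.1, by simpa using hp.2.1⟩, by simpa using hp.2.2⟩

lemma Isomorphic.prod_pt (S : Site) {X : KScheme k} (F : Sieve X) :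
    Isomorphic S (F.prod (all (pt k))) F := by
  refine .of_ambient (fst _ _) (lift (𝟙 _) (toPt _)) ?_ ?_ ?_ ?_
  · apply prod_ext
    · simp
    · exact toPt_unique _ _
  · simp
  · exact fun w p hp => hp.1
  · exact fun w p hp => ⟨by simpa using hp, trivial⟩

end Sieve

variable (k) in
/-- A sub-Zariski motif: a sub-Zariski sieve on some `k`-scheme. -/
structure Motif where
  /-- the ambient space -/
  ambient : KScheme k
  /-- the sieve -/
  sieve : Sieve ambient
  isSubZariski : sieve.IsSubZariski

/-- The motif of all points of a `k`-scheme. -/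
def Motif.ofScheme (X : KScheme k) : Motif k := ⟨X, .all X, Sieve.isSubZariski_all X⟩

/-- The product of two motives. -/
def Motif.prod (M N : Motif k) : Motif k :=
  ⟨_, M.sieve.prod N.sieve, M.isSubZariski.prod N.isSubZariski⟩

/-- Isomorphism of motives. -/
def Motif.Isomorphic (S : Site) (M N : Motif k) : Prop := Sieve.Isomorphic S M.sieve N.sieve

/-! ### The Grothendieck ring -/

variable (k) in
/-- Isomorphism classes of sub-Zariski motives in the given site. -/
def MotifClass (S : Site) : Type (u + 1) := Quot (Motif.Isomorphic (k := k) S)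

/-- Isomorphism classes form a commutative monoid under products over `k`. -/
instance (S : Site) : CommMonoid (MotifClass k S) where
  mul := Quot.map₂ Motif.prod
    (fun M _ _ h => Sieve.Isomorphic.prod (Sieve.Isomorphic.refl S M.sieve) h)
    (fun _ _ N h => Sieve.Isomorphic.prod h (Sieve.Isomorphic.refl S N.sieve))
  mul_assoc := by
    rintro ⟨M⟩ ⟨N⟩ ⟨P⟩
    exact Quot.sound (a := (M.prod N).prod P) (b := M.prod (N.prod P))
      (Sieve.Isomorphic.prod_assoc S M.sieve N.sieve P.sieve)
  mul_comm := by
    rintro ⟨M⟩ ⟨N⟩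
    exact Quot.sound (a := M.prod N) (b := N.prod M)
      (Sieve.Isomorphic.prod_comm S M.sieve N.sieve)
  one := Quot.mk _ (Motif.ofScheme (pt k))
  mul_one := by
    rintro ⟨M⟩
    exact Quot.sound (a := M.prod (Motif.ofScheme (pt k))) (b := M)
      (Sieve.Isomorphic.prod_pt S M.sieve)
  one_mul := by
    rintro ⟨M⟩
    exact (Quot.sound (a := (Motif.ofScheme (pt k)).prod M) (b := M.prod (Motif.ofScheme (pt k)))
      (Sieve.Isomorphic.prod_comm S (.all (pt k)) M.sieve)).trans
      (Quot.sound (a := M.prod (Motif.ofScheme (pt k))) (b := M)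
        (Sieve.Isomorphic.prod_pt S M.sieve))

/-- The symbol of a motif in the free abelian group on isomorphism classes, which is a ring under
the product. -/
def symbol (S : Site) (M : Motif k) : MonoidAlgebra ℤ (MotifClass k S) :=
  MonoidAlgebra.of ℤ (MotifClass k S) (Quot.mk _ M)

variable (k) in
/-- The scissor relations `⟨F⟩ + ⟨G⟩ - ⟨F ∪ G⟩ - ⟨F ∩ G⟩` for sub-Zariski sieves on a common
`k`-scheme. (Union and intersection are automatically sub-Zariski, through disjoint unions and
fiber products.) -/
def scissorRelations (S : Site) : Set (MonoidAlgebra ℤ (MotifClass k S)) :=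
  {r | ∃ (X : KScheme k) (F G : Sieve X) (hF : F.IsSubZariski) (hG : G.IsSubZariski)
    (hU : (F.union G).IsSubZariski) (hI : (F.inter G).IsSubZariski),
    r = symbol S ⟨X, F, hF⟩ + symbol S ⟨X, G, hG⟩
      - symbol S ⟨X, F.union G, hU⟩ - symbol S ⟨X, F.inter G, hI⟩}

variable (k) in
/-- The Grothendieck ring of the site of sub-Zariski motives: the free abelian group on
sub-Zariski motives modulo the isomorphism relations and the scissor relations, with
multiplication induced by the product. -/
def GrothendieckRing (S : Site) : Type (u + 1) :=
  MonoidAlgebra ℤ (MotifClass k S) ⧸ Ideal.span (scissorRelations k S)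

instance (S : Site) : CommRing (GrothendieckRing k S) :=
  inferInstanceAs (CommRing (MonoidAlgebra ℤ (MotifClass k S) ⧸ _))

/-- The class of a `k`-scheme in the Grothendieck ring. -/
def schemeClass (S : Site) (X : KScheme k) : GrothendieckRing k S :=
  Ideal.Quotient.mk (Ideal.span (scissorRelations k S)) (symbol S (Motif.ofScheme X))

variable (k) in
/-- The Lefschetz class: the class of the affine line. -/
def lefschetz (S : Site) : GrothendieckRing k S := schemeClass S (KScheme.affineSpace k 1)

end FatArc

end

noncomputable section

namespace FatArc

variable {k : Type u} [Field k]

open KScheme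

/-! ### Algebra -/

section Algebra

/-! A smooth `X` of dimension `d` is covered by affine opens `U` that are étale over affine
`d`-space (`exists_isEtaleChart`). For a closed immersion `z' ⟶ z`, the functions on `z × T` surject
onto those on `z' × T` with nilpotent kernel. By the infinitesimal lifting property, extending a
family `z' × T ⟶ U` to `z × T` amounts to lifting the `d` coordinate functions arbitrarily
(`existsUnique_lift_of_formallyEtale`). In a `k`-basis of the coordinate ring of `z` adapted to the
kernel, a lift of one function is a free choice of `l - l'` functions on `T`. Hence, naturally in
`T`, arcs along `z` in `U` are arcs along `z'` together with a point of affine space of dimension `d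
* (l - l')` (`AdaptedBasis.exists_trivialization`).

Since `k` is algebraically closed, length is dimension over `k`, and the closed point of `z` is a
closed immersion of `Spec k`. Arcs along `Spec k` are just points of `X`, so taking `z'` to be that
point produces arc schemes of charts, and a general `z'` gives the local product structure of
restriction maps.

Localisation on `X` works because `z × T` has no more points than `T`: a family of arcs lies in an
open subset as soon as its base points do. Arc schemes of opens are therefore preimages under the
base point map, and they glue (`nonempty_arcScheme_of_cover`).

For the class formula, a fat point has one point, so the sieve of a union of opens is the union of
their sieves. The scissor relations then give Mayer–Vietoris for opens, and quasi-compactness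
extends the product formula from trivialising opens to the whole base
(`schemeClass_eq_mul_of_isTrivialOver`). It is applied to the base point map, with fiber of
dimension `d * (l - 1)`. All isomorphisms of sieves used are explicit, so both variants of the ring
are covered at once. -/

/-- Formally étale algebras over a polynomial ring lift uniquely along nilpotent thickenings, once
the images of the coordinates are prescribed. -/
theorem existsUnique_lift_of_formallyEtale {k σ S C C' : Type*} [CommRing k] [CommRing S]
    [CommRing C] [CommRing C'] [Algebra k S] [Algebra k C] [Algebra k C']
    (g : MvPolynomial σ k →ₐ[k] S) (hg : g.toRingHom.FormallyEtale)
    (q : C →ₐ[k] C') (hq : Function.Surjective q) (hker : IsNilpotent (RingHom.ker q))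
    (φ' : S →ₐ[k] C') (y : σ → C) (hy : ∀ j, q (y j) = φ' (g (.X j))) :
    ∃! φ : S →ₐ[k] C, q.comp φ = φ' ∧ ∀ j, φ (g (.X j)) = y j := by
  -- The values `y j` make `C` and `C'` algebras over the polynomial ring. The lifts sought are
  -- exactly the `P`-algebra lifts of `φ'` through `q`: formal smoothness gives existence, formal
  -- unramifiedness uniqueness.
  let P := MvPolynomial σ k
  let : Algebra P S := g.toRingHom.toAlgebra
  let : Algebra P C := (MvPolynomial.aeval y : P →ₐ[k] C).toRingHom.toAlgebra
  let : Algebra P C' := (q.comp (MvPolynomial.aeval y : P →ₐ[k] C)).toRingHom.toAlgebra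
  have : Algebra.FormallyEtale P S := hg
  have : IsScalarTower k P S := .of_algebraMap_eq fun r => (g.commutes r).symm
  have : IsScalarTower k P C :=
    .of_algebraMap_eq fun r => ((MvPolynomial.aeval y : P →ₐ[k] C).commutes r).symm
  have : IsScalarTower k P C' :=
    .of_algebraMap_eq fun r => ((q.comp (MvPolynomial.aeval y : P →ₐ[k] C)).commutes r).symm
  let qP : C →ₐ[P] C' := { q.toRingHom with commutes' := fun _ => rfl }
  have key : φ'.comp g = q.comp (MvPolynomial.aeval y) := by
    ext j
    simp [hy]
  let φP : S →ₐ[P] C' :=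
    { φ'.toRingHom with commutes' := fun p => DFunLike.congr_fun key p }
  have hkP : IsNilpotent (RingHom.ker (qP : C →+* C')) := hker
  let L : S →ₐ[P] C := Algebra.FormallySmooth.liftOfSurjective φP qP hq hkP
  have hL : qP.comp L = φP := Algebra.FormallySmooth.comp_liftOfSurjective φP qP hq hkP
  have hX (j : σ) : algebraMap P C (.X j) = y j := MvPolynomial.aeval_X y j
  refine ⟨L.restrictScalars k, ⟨?_, fun j => ?_⟩, ?_⟩
  · ext s
    exact DFunLike.congr_fun hL s
  · exact (L.commutes (.X j)).trans (hX j)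
  · rintro ψ ⟨h₁, h₂⟩
    have h₃ : ψ.comp g = MvPolynomial.aeval y := by
      ext j
      simp [h₂]
    let ψP : S →ₐ[P] C := { ψ.toRingHom with commutes' := fun p => DFunLike.congr_fun h₃ p }
    have : ψP = L := by
      refine Algebra.FormallyUnramified.lift_unique_of_ringHom (qP : C →+* C') hkP _ _ ?_
      ext s
      exact (DFunLike.congr_fun h₁ s).trans (DFunLike.congr_fun hL s).symm
    ext s
    exact DFunLike.congr_fun this s

/-- The length of a finite local algebra over an algebraically closed field is its dimension. -/
theorem toNat_length_eq_finrank {k R : Type*} [Field k] [IsAlgClosed k] [CommRing R] [Algebra k R]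
    [IsLocalRing R] [Module.Finite k R] :
    (Module.length R R).toNat = Module.finrank k R := by
  have : IsLocalHom (algebraMap k R) := by
    refine ⟨fun a ha => ?_⟩
    rw [isUnit_iff_ne_zero]
    rintro rfl
    simp at ha
  have hfin : Module.Finite k (IsLocalRing.ResidueField R) :=
    .of_surjective (IsScalarTower.toAlgHom k R (IsLocalRing.ResidueField R)).toLinearMap
      IsLocalRing.residue_surjective
  -- The residue field is `k` itself, so the residue degree relating length over `R` to dimension
  -- over `k` is one.
  have hbij : Function.Bijective (algebraMap k (IsLocalRing.ResidueField R)) :=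
    IsAlgClosed.algebraMap_bijective_of_isIntegral
  have h1 : Module.length (IsLocalRing.ResidueField k) (IsLocalRing.ResidueField R) = 1 := by
    rw [← Module.length_eq_of_surjective (R := IsLocalRing.ResidueField k) (S := k)
      (M := IsLocalRing.ResidueField R) IsLocalRing.residue_surjective,
      Module.length_eq_of_surjective (R := IsLocalRing.ResidueField R) hbij.2]
    exact Module.length_eq_one _ _
  have h2 := IsLocalRing.length_restrictScalars k R R
  rw [h1, mul_one, Module.length_eq_finrank] at h2
  rw [← h2]
  rfl

/-- A basis adapted to the kernel of a surjective linear map. -/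
theorem exists_basis_sum_of_surjective {k V W : Type*} [Field k] [AddCommGroup V] [AddCommGroup W]
    [Module k V] [Module k W] [FiniteDimensional k V] (f : V →ₗ[k] W)
    (hf : Function.Surjective f) :
    ∃ (b : Module.Basis (Fin (Module.finrank k W) ⊕
        Fin (Module.finrank k V - Module.finrank k W)) k V)
      (b' : Module.Basis (Fin (Module.finrank k W)) k W),
      (∀ i, f (b (.inl i)) = b' i) ∧ ∀ i, f (b (.inr i)) = 0 := by
  have : FiniteDimensional k W := Module.Finite.of_surjective f hf
  -- A linear section `s` splits `V` as `range s ⊕ ker f`; the basis joins the image of `b'` under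
  -- `s` to a basis of the kernel.
  obtain ⟨s, hs⟩ := f.exists_rightInverse_of_surjective (LinearMap.range_eq_top.mpr hf)
  have hfs (w : W) : f (s w) = w := DFunLike.congr_fun hs w
  have hsinj : Function.Injective s := fun a b h => by rw [← hfs a, ← hfs b, h]
  let b' := Module.finBasis k W
  have hdim : Module.finrank k (LinearMap.ker f) = Module.finrank k V - Module.finrank k W := by
    have := f.finrank_range_add_finrank_ker
    rw [LinearMap.range_eq_top.mpr hf, finrank_top] at this
    omega
  let n := Module.finBasisOfFinrankEq k (LinearMap.ker f) hdim
  have hc : IsCompl (LinearMap.range s) (LinearMap.ker f) := by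
    refine ⟨?_, ?_⟩
    · rw [Submodule.disjoint_def]
      rintro _ ⟨w, rfl⟩ hw
      have : w = 0 := by rw [← hfs w]; exact hw
      simp [this]
    · rw [codisjoint_iff, eq_top_iff]
      intro v _
      refine Submodule.mem_sup.mpr ⟨s (f v), ⟨_, rfl⟩, v - s (f v), ?_, by abel⟩
      simp [hfs]
  let e := (LinearEquiv.ofInjective s hsinj).prodCongr (LinearEquiv.refl k (LinearMap.ker f))
    |>.trans (Submodule.prodEquivOfIsCompl _ _ hc)
  refine ⟨(b'.prod n).map e, b', fun i => ?_, fun i => ?_⟩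
  · simp [e, hfs]
  · simp [e]

end Algebra

/-! ### Global sections of `k`-schemes -/

namespace KScheme

instance (X : KScheme k) : Algebra k Γ(X.toScheme, ⊤) :=
  ((Scheme.ΓSpecIso (.of k)).inv ≫ X.str.appTop).hom.toAlgebra

lemma algebraMap_eq (X : KScheme k) : algebraMap k Γ(X.toScheme, ⊤) =
    ((Scheme.ΓSpecIso (.of k)).inv ≫ X.str.appTop).hom := rfl

/-- Pull-back of global functions. -/
def pull {X Y : KScheme k} (f : X ⟶ Y) : Γ(Y.toScheme, ⊤) →ₐ[k] Γ(X.toScheme, ⊤) :=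
  { (mor f).appTop.hom with
    commutes' := fun r => by
      have h : Y.str.appTop ≫ (mor f).appTop = X.str.appTop := by
        rw [← mor_str f, Scheme.Hom.comp_appTop]
      exact congr($h ((Scheme.ΓSpecIso (.of k)).inv r)) }

lemma pull_comp {X Y Z : KScheme k} (f : X ⟶ Y) (g : Y ⟶ Z) :
    pull (f ≫ g) = (pull f).comp (pull g) := by
  ext s
  have h : (mor (f ≫ g)).appTop = (mor g).appTop ≫ (mor f).appTop :=
    Scheme.Hom.comp_appTop (mor f) (mor g)
  exact congr($h s)

lemma pull_comp_apply {X Y Z : KScheme k} (f : X ⟶ Y) (g : Y ⟶ Z) (s : Γ(Z.toScheme, ⊤)) :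
    pull (f ≫ g) s = pull f (pull g s) := by
  rw [pull_comp]; rfl

/-- Morphisms to an affine `k`-scheme are homomorphisms of algebras of global functions. -/
lemma pull_bijective (X Y : KScheme k) [IsAffine Y.toScheme] :
    Function.Bijective (pull : (X ⟶ Y) → _) := by
  refine ⟨fun f g h => mor_ext (ext_of_isAffine ?_), fun φ => ?_⟩
  · ext s
    exact DFunLike.congr_fun h s
  · let f : X.toScheme ⟶ Y.toScheme :=
      X.toScheme.toSpecΓ ≫ Spec.map (CommRingCat.ofHom φ.toRingHom) ≫ Y.toScheme.isoSpec.inv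
    have hf : f.appTop = CommRingCat.ofHom φ.toRingHom := by
      have h : Y.toScheme.isoSpec.inv.appTop = (Scheme.ΓSpecIso _).inv := by
        rw [← cancel_epi (Scheme.ΓSpecIso _).hom, Iso.hom_inv_id, ← Scheme.toSpecΓ_appTop,
          ← Scheme.isoSpec_hom, ← Scheme.Hom.comp_appTop, Iso.inv_hom_id, Scheme.Hom.id_appTop]
      rw [Scheme.Hom.comp_appTop, Scheme.Hom.comp_appTop, h, Scheme.toSpecΓ_appTop,
        Category.assoc, Scheme.ΓSpecIso_naturality]
      exact Iso.inv_hom_id_assoc _ _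
    refine ⟨homMk f (ext_of_isAffine ?_), ?_⟩
    · rw [Scheme.Hom.comp_appTop, hf, ← cancel_epi (Scheme.ΓSpecIso (.of k)).inv]
      ext r
      exact φ.commutes r
    · ext s
      exact congr($hf s)

/-- Morphisms to affine space are tuples of functions. -/
def coords {X : KScheme k} {n : ℕ} (f : X ⟶ affineSpace k n) (i : Fin n) : Γ(X.toScheme, ⊤) :=
  (mor f).appTop (AffineSpace.coord (Spec (.of k)) (ULift.up i))

lemma coords_comp {X Y : KScheme k} {n : ℕ} (g : X ⟶ Y) (f : Y ⟶ affineSpace k n) (i : Fin n) :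
    coords (g ≫ f) i = pull g (coords f i) := by
  have h : (mor (g ≫ f)).appTop = (mor f).appTop ≫ (mor g).appTop :=
    Scheme.Hom.comp_appTop (mor g) (mor f)
  exact congr($h _)

lemma coords_bijective (X : KScheme k) (n : ℕ) :
    Function.Bijective (coords : (X ⟶ affineSpace k n) → _) := by
  refine ⟨fun f g h => mor_ext (AffineSpace.hom_ext ((mor_str f).trans (mor_str g).symm) ?_),
    fun v => ⟨homMk (AffineSpace.homOfVector X.str fun i => v i.down) (by
      exact AffineSpace.homOfVector_over _ _), ?_⟩⟩
  · rintro ⟨i⟩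
    exact congrFun h i
  · ext i
    exact AffineSpace.homOfVector_appTop_coord _ _ _

end KScheme

/-- The affine scheme `Spec k` has the base field as its ring of functions. -/
lemma algebraMap_pt_bijective : Function.Bijective (algebraMap k Γ((pt k).toScheme, ⊤)) := by
  have h : algebraMap k Γ((pt k).toScheme, ⊤) = (Scheme.ΓSpecIso (.of k)).inv.hom := by
    have : (pt k).str.appTop = 𝟙 _ := Scheme.Hom.id_appTop (X := Spec (.of k))
    rw [algebraMap_eq, this]
    exact congrArg CommRingCat.Hom.hom (Category.comp_id _)
  rw [h]
  exact ConcreteCategory.bijective_of_isIso (Scheme.ΓSpecIso (.of k)).inv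

/-! ### Coordinate rings of fat points -/

section FatPoint

variable (z : FatPoint k)

instance : IsFinite z.obj.str := z.property.1

instance : IsAffine z.obj.toScheme := isAffine_of_isAffineHom z.obj.str

instance : Unique z.obj.toScheme := z.property.2.some

instance : Module.Finite k Γ(z.obj.toScheme, ⊤) := by
  have h := z.obj.str.finite_appTop
  have h' : ((Scheme.ΓSpecIso (.of k)).inv).hom.Finite :=
    .of_surjective _ (ConcreteCategory.bijective_of_isIso (Scheme.ΓSpecIso (.of k)).inv).2
  exact h.comp h'

instance : Unique (PrimeSpectrum Γ(z.obj.toScheme, ⊤)) :=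
  Equiv.unique (Scheme.homeoOfIso z.obj.toScheme.isoSpec).symm.toEquiv

instance : IsLocalRing Γ(z.obj.toScheme, ⊤) := by
  have : Subsingleton (MaximalSpectrum Γ(z.obj.toScheme, ⊤)) :=
    MaximalSpectrum.toPrimeSpectrum_injective.subsingleton
  have : Nontrivial Γ(z.obj.toScheme, ⊤) :=
    PrimeSpectrum.nonempty_iff_nontrivial.mp ⟨default⟩
  exact .of_singleton_maximalSpectrum

lemma FatPoint.length_eq_finrank [IsAlgClosed k] :
    z.length = Module.finrank k Γ(z.obj.toScheme, ⊤) :=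
  toNat_length_eq_finrank

end FatPoint

/-! ### Functions on `z × T` and arcs in étale charts -/

section Product

instance (T : KScheme k) : CompactSpace T.toScheme :=
  QuasiCompact.compactSpace_of_compactSpace T.str

instance (T : KScheme k) : QuasiSeparatedSpace T.toScheme :=
  quasiSeparatedSpace_of_quasiSeparated T.str

variable (z : FatPoint k)

/-- Flat base change for global sections: `z` is affine and flat over the field, and `T`, which need
not be affine, is quasi-compact and quasi-separated. -/
lemma isPushout_pull_prod (T : KScheme k) :
    IsPushout (CommRingCat.ofHom (algebraMap k Γ(T.toScheme, ⊤)))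
      (CommRingCat.ofHom (algebraMap k Γ(z.obj.toScheme, ⊤)))
      (CommRingCat.ofHom (pull (snd z.obj T)).toRingHom)
      (CommRingCat.ofHom (pull (fst z.obj T)).toRingHom) := by
  have H : IsPullback (mor (snd z.obj T)) (mor (fst z.obj T)) T.str z.obj.str :=
    (IsPullback.of_hasPullback z.obj.str T.str).flip
  have h₁ := (isIso_pushoutSection_iff H _ _ _).mp (show IsIso
    (pushoutSection H (US := ⊤) (UT := ⊤) (UX := ⊤) (UY := ⊤) le_top le_top
      (by simp)) from
    isIso_pushoutSection_of_isQuasiSeparated_of_flat_right H _ _ _ (isAffineOpen_top _)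
      (isAffineOpen_top _) isCompact_univ isQuasiSeparated_univ)
  have hle {X Y : Scheme.{u}} (f : X ⟶ Y) (h) : f.appLE ⊤ ⊤ h = f.appTop :=
    Scheme.Hom.appLE_eq_app f
  have h₂ : IsPushout T.str.appTop z.obj.str.appTop (mor (snd z.obj T)).appTop
      (mor (fst z.obj T)).appTop := by
    convert h₁ using 1 <;> exact (hle _ _).symm
  refine h₂.of_iso (Scheme.ΓSpecIso (.of k)) (Iso.refl _) (Iso.refl _) (Iso.refl _) ?_ ?_ ?_ ?_
  · exact (Category.comp_id _).trans
      (Iso.hom_inv_id_assoc (Scheme.ΓSpecIso (.of k)) T.str.appTop).symm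
  · exact (Category.comp_id _).trans
      (Iso.hom_inv_id_assoc (Scheme.ΓSpecIso (.of k)) z.obj.str.appTop).symm
  · exact (Category.comp_id _).trans (Category.id_comp _).symm
  · exact (Category.comp_id _).trans (Category.id_comp _).symm

/-- A basis of the coordinate ring of a fat point is a basis of the functions on `z × T` over the
functions on `T`. -/
lemma bijective_sum_pull {ι : Type*} [Fintype ι] (b : Module.Basis ι k Γ(z.obj.toScheme, ⊤))
    (T : KScheme k) : Function.Bijective fun a : ι → Γ(T.toScheme, ⊤) =>
      ∑ i, pull (fst z.obj T) (b i) * pull (snd z.obj T) (a i) := by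
  let : Algebra Γ(T.toScheme, ⊤) Γ((z.obj.prod T).toScheme, ⊤) :=
    (pull (snd z.obj T)).toRingHom.toAlgebra
  let : Algebra Γ(z.obj.toScheme, ⊤) Γ((z.obj.prod T).toScheme, ⊤) :=
    (pull (fst z.obj T)).toRingHom.toAlgebra
  have : IsScalarTower k Γ(T.toScheme, ⊤) Γ((z.obj.prod T).toScheme, ⊤) :=
    .of_algebraMap_eq fun r => ((pull (snd z.obj T)).commutes r).symm
  have : IsScalarTower k Γ(z.obj.toScheme, ⊤) Γ((z.obj.prod T).toScheme, ⊤) :=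
    .of_algebraMap_eq fun r => ((pull (fst z.obj T)).commutes r).symm
  have h : Algebra.IsPushout k Γ(T.toScheme, ⊤) Γ(z.obj.toScheme, ⊤)
      Γ((z.obj.prod T).toScheme, ⊤) :=
    (CommRingCat.isPushout_iff_isPushout).mp (isPushout_pull_prod z T)
  have hB (i : ι) : h.out.basis b i = pull (fst z.obj T) (b i) := h.out.basis_apply b i
  convert (h.out.basis b).equivFun.symm.bijective using 1
  ext a
  rw [Module.Basis.equivFun_symm_apply]
  refine Finset.sum_congr rfl fun i _ => ?_
  rw [Algebra.smul_def, hB, mul_comm]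
  rfl

/-- A basis of the coordinate ring of a fat point that is adapted to a closed immersion. -/
structure AdaptedBasis {z z' : FatPoint k} (i : z' ⟶ z) (m n : ℕ) where
  /-- the basis upstairs -/
  big : Module.Basis (Fin m ⊕ Fin n) k Γ(z.obj.toScheme, ⊤)
  /-- the basis downstairs -/
  small : Module.Basis (Fin m) k Γ(z'.obj.toScheme, ⊤)
  pull_inl : ∀ j, pull i.hom (big (.inl j)) = small j
  pull_inr : ∀ j, pull i.hom (big (.inr j)) = 0

variable {z} {z' : FatPoint k} (i : z' ⟶ z)

/-- A closed immersion of affine schemes is surjective on functions, so the linear algebra applies;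
algebraic closedness turns dimensions into lengths. -/
lemma exists_adaptedBasis [IsAlgClosed k] [IsClosedImmersion (mor i.hom)] :
    Nonempty (AdaptedBasis i z'.length (z.length - z'.length)) := by
  have hs : Function.Surjective (pull i.hom).toLinearMap :=
    (IsClosedImmersion.isAffine_surjective_of_isAffine (mor i.hom)).2
  obtain ⟨b, b', h₁, h₂⟩ := exists_basis_sum_of_surjective (pull i.hom).toLinearMap hs
  rw [z.length_eq_finrank, z'.length_eq_finrank]
  exact ⟨⟨b, b', h₁, h₂⟩⟩

variable {i} {m n : ℕ} (b : AdaptedBasis i m n)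

namespace AdaptedBasis

/-- The functions on `z × T` in terms of coefficients, which are functions on `T`. -/
def coeff (T : KScheme k) :
    Γ((z.obj.prod T).toScheme, ⊤) ≃ (Fin m ⊕ Fin n → Γ(T.toScheme, ⊤)) :=
  (Equiv.ofBijective _ (bijective_sum_pull z b.big T)).symm

/-- The functions on `z' × T` in terms of coefficients, which are functions on `T`. -/
def coeff' (T : KScheme k) :
    Γ((z'.obj.prod T).toScheme, ⊤) ≃ (Fin m → Γ(T.toScheme, ⊤)) :=
  (Equiv.ofBijective _ (bijective_sum_pull z' b.small T)).symm

lemma coeff_symm_apply (T : KScheme k) (a : Fin m ⊕ Fin n → Γ(T.toScheme, ⊤)) :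
    (b.coeff T).symm a = ∑ i, pull (fst z.obj T) (b.big i) * pull (snd z.obj T) (a i) := rfl

lemma coeff'_symm_apply (T : KScheme k) (a : Fin m → Γ(T.toScheme, ⊤)) :
    (b.coeff' T).symm a = ∑ i, pull (fst z'.obj T) (b.small i) * pull (snd z'.obj T) (a i) := rfl

/-- The basis lives on `z` and is unaffected by a change of `T`. This is what makes the affine space
component of the trivialization natural. -/
lemma coeff_naturality {S T : KScheme k} (f : S ⟶ T) (s : Γ((z.obj.prod T).toScheme, ⊤)) :
    b.coeff S (pull (map (𝟙 _) f) s) = fun i => pull f (b.coeff T s i) := by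
  rw [← Equiv.eq_symm_apply, coeff_symm_apply]
  conv_lhs => rw [← (b.coeff T).symm_apply_apply s, coeff_symm_apply]
  simp only [map_sum, map_mul, ← pull_comp_apply, map_fst, map_snd, Category.comp_id]

/-- Since the basis is adapted, restriction to `z' × T` merely forgets the `inr` coefficients. -/
lemma pull_coeff_symm (T : KScheme k) (a : Fin m ⊕ Fin n → Γ(T.toScheme, ⊤)) :
    pull (map i.hom (𝟙 T)) ((b.coeff T).symm a) = (b.coeff' T).symm fun j => a (.inl j) := by
  have hf (s) : pull (map i.hom (𝟙 T)) (pull (fst z.obj T) s) =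
      pull (fst z'.obj T) (pull i.hom s) := by
    rw [← pull_comp_apply, map_fst, pull_comp_apply]
  have hs (s) : pull (map i.hom (𝟙 T)) (pull (snd z.obj T) s) = pull (snd z'.obj T) s := by
    rw [← pull_comp_apply, map_snd, Category.comp_id]
  rw [coeff_symm_apply, coeff'_symm_apply]
  simp [hf, hs, b.pull_inl, b.pull_inr]

lemma coeff'_pull (T : KScheme k) (s : Γ((z.obj.prod T).toScheme, ⊤)) :
    b.coeff' T (pull (map i.hom (𝟙 T)) s) = fun j => b.coeff T s (.inl j) := by
  conv_lhs => rw [← (b.coeff T).symm_apply_apply s, pull_coeff_symm, Equiv.apply_symm_apply]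

include b in
lemma pull_map_surjective (T : KScheme k) :
    Function.Surjective (pull (map i.hom (𝟙 T))) := fun s =>
  ⟨(b.coeff T).symm (Sum.elim (b.coeff' T s) 0), by simp [b.pull_coeff_symm]⟩

-- The kernel is contained in the ideal generated by the finitely many `inr` basis elements. Each of
-- these is nilpotent on `z`, because the unique prime there is the pullback of a prime on `z'`,
-- where the element vanishes.
include b in
lemma isNilpotent_ker_pull_map (T : KScheme k) :
    IsNilpotent (RingHom.ker (pull (map i.hom (𝟙 T)))) := by
  let J : Ideal Γ((z.obj.prod T).toScheme, ⊤) :=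
    Ideal.span (Set.range fun j => pull (fst z.obj T) (b.big (.inr j)))
  have hJ : RingHom.ker (pull (map i.hom (𝟙 T))) ≤ J := by
    intro s hs
    have h : (fun j => b.coeff T s (.inl j)) = b.coeff' T 0 := by
      rw [← b.coeff'_pull]
      exact congrArg _ hs
    have h0 : b.coeff' T 0 = 0 := by
      rw [← Equiv.eq_symm_apply, coeff'_symm_apply]
      simp
    rw [← (b.coeff T).symm_apply_apply s, coeff_symm_apply, Fintype.sum_sum_type]
    refine add_mem ?_ (sum_mem fun j _ => J.mul_mem_right _ (Ideal.subset_span ⟨j, rfl⟩))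
    refine sum_mem fun j _ => ?_
    have : b.coeff T s (.inl j) = 0 := congrFun (h.trans h0) j
    simp [this]
  have hN : IsNilpotent J := by
    rw [Ideal.FG.isNilpotent_iff_le_nilradical (Submodule.fg_span (Set.finite_range _))]
    refine Ideal.span_le.mpr ?_
    rintro _ ⟨j, rfl⟩
    refine IsNilpotent.map (r := b.big (.inr j)) ?_ (pull (fst z.obj T))
    rw [nilpotent_iff_mem_prime]
    intro p hp
    let Q : PrimeSpectrum Γ(z'.obj.toScheme, ⊤) := default
    have h : p = Q.asIdeal.comap (pull i.hom).toRingHom := congrArg PrimeSpectrum.asIdeal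
      (Subsingleton.elim (⟨p, hp⟩ : PrimeSpectrum _) (PrimeSpectrum.comap _ Q))
    rw [h, Ideal.mem_comap]
    exact (b.pull_inr j).symm ▸ Q.asIdeal.zero_mem
  obtain ⟨N, hN⟩ := hN
  exact ⟨N, le_bot_iff.mp ((Ideal.pow_right_mono hJ N).trans hN.le)⟩

end AdaptedBasis

/-- Affine `k`-schemes that are étale over affine space of dimension `d`. -/
def IsEtaleChart (d : ℕ) (U : KScheme k) : Prop :=
  IsAffine U.toScheme ∧
    ∃ g : MvPolynomial (Fin d) k →ₐ[k] Γ(U.toScheme, ⊤), g.toRingHom.FormallyEtale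

include b in
/-- Arcs along `z` in an étale chart are arcs along a closed subscheme `z'` together with
a point of an affine space. -/
theorem AdaptedBasis.exists_trivialization {d : ℕ} {U : KScheme k} (hU : IsEtaleChart d U) :
    ∃ ρ : ∀ T : KScheme k, (z.obj.prod T ⟶ U) → (T ⟶ affineSpace k (d * n)),
      (∀ {S T : KScheme k} (f : S ⟶ T) (β : z.obj.prod T ⟶ U),
        ρ S (map (𝟙 _) f ≫ β) = f ≫ ρ T β) ∧
      ∀ T, Function.Bijective fun β => ((map i.hom (𝟙 T) ≫ β : z'.obj.prod T ⟶ U), ρ T β) := by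
  obtain ⟨_, g, hg⟩ := hU
  obtain ⟨e⟩ : Nonempty (Fin d × Fin n ≃ Fin (d * n)) := ⟨finProdFinEquiv⟩
  let F (T : KScheme k) := Equiv.ofBijective _ (coords_bijective T (d * n))
  -- Of each coordinate of the arc, `r` keeps the `inr` coefficients, precisely the data invisible
  -- on `z'`; there are `d * n` of them.
  let r (T : KScheme k) (β : z.obj.prod T ⟶ U) (t : Fin (d * n)) : Γ(T.toScheme, ⊤) :=
    b.coeff T (pull β (g (.X (e.symm t).1))) (.inr (e.symm t).2)
  refine ⟨fun T β => (F T).symm (r T β), fun {S T} f β => ?_, fun T => ?_⟩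
  · rw [Equiv.symm_apply_eq]
    ext t
    change _ = coords (f ≫ _) t
    have : coords ((F T).symm (r T β)) = r T β := (F T).apply_symm_apply _
    rw [coords_comp, this]
    simp only [r, pull_comp_apply, b.coeff_naturality]
  · rw [Function.bijective_iff_existsUnique]
    rintro ⟨β', v⟩
    -- The `inl` coefficients of the `j`-th coordinate are forced by `β'`, while the `inr` ones are
    -- read off from the point `v`.
    let w (j : Fin d) : Fin m ⊕ Fin n → Γ(T.toScheme, ⊤) :=
      Sum.elim (b.coeff' T (pull β' (g (.X j)))) fun l => F T v (e (j, l))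
    obtain ⟨φ, ⟨h₁, h₂⟩, h₃⟩ := existsUnique_lift_of_formallyEtale g hg
      (pull (map i.hom (𝟙 T))) (b.pull_map_surjective T) (b.isNilpotent_ker_pull_map T)
      (pull β') (fun j => (b.coeff T).symm (w j))
      (fun j => by simp [b.pull_coeff_symm, w])
    obtain ⟨β, rfl⟩ := (pull_bijective _ U).2 φ
    refine ⟨β, Prod.ext ((pull_bijective _ U).1 ?_) ?_, fun γ hγ => ?_⟩
    · rw [pull_comp, h₁]
    · rw [Equiv.symm_apply_eq]
      ext t
      simp [r, h₂, w]
    · obtain ⟨rfl, hv⟩ := Prod.ext_iff.mp hγ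
      replace hv := (Equiv.symm_apply_eq _).mp hv
      refine (pull_bijective _ U).1 (h₃ _ ⟨(pull_comp _ _).symm, fun j => ?_⟩)
      rw [Equiv.eq_symm_apply]
      ext (l | l)
      · simp [w, pull_comp_apply, b.coeff'_pull]
      · simp [w, ← hv, r]

end Product

/-! ### Open subschemes -/

namespace KScheme

lemma mor_comp {X Y Z : KScheme k} (f : X ⟶ Y) (g : Y ⟶ Z) : mor (f ≫ g) = mor f ≫ mor g := rfl

lemma mor_comp_apply {X Y Z : KScheme k} (f : X ⟶ Y) (g : Y ⟶ Z) (x : X.toScheme) :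
    mor (f ≫ g) x = mor g (mor f x) := rfl

instance (X : KScheme k) : IsLocallyNoetherian X.toScheme :=
  LocallyOfFiniteType.isLocallyNoetherian X.str

/-- An open subscheme of a `k`-scheme. -/
def opn (X : KScheme k) (V : X.toScheme.Opens) : KScheme k := mk (V.ι ≫ X.str)

/-- The inclusion of an open subscheme. -/
def opnι (X : KScheme k) (V : X.toScheme.Opens) : X.opn V ⟶ X := homMk V.ι rfl

instance (X : KScheme k) (V : X.toScheme.Opens) : IsOpenImmersion (mor (X.opnι V)) :=
  inferInstanceAs (IsOpenImmersion V.ι)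

lemma opensRange_opnι (X : KScheme k) (V : X.toScheme.Opens) :
    (mor (X.opnι V)).opensRange = V := V.opensRange_ι

lemma opnι_mem (X : KScheme k) (V : X.toScheme.Opens) (x : (X.opn V).toScheme) :
    mor (X.opnι V) x ∈ V := x.2

section OpenImmersion

variable {U X T : KScheme k} (j : U ⟶ X) [IsOpenImmersion (mor j)]

lemma openImmersion_cancel {f g : T ⟶ U} (h : f ≫ j = g ≫ j) : f = g :=
  mor_ext ((cancel_mono (mor j)).mp (congrArg mor h))

lemma mem_opensRange (u : U.toScheme) : mor j u ∈ (mor j).opensRange := ⟨u, rfl⟩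

/-- Morphisms into an open subscheme. -/
def openLift (f : T ⟶ X) (h : ∀ t, mor f t ∈ (mor j).opensRange) : T ⟶ U :=
  homMk (IsOpenImmersion.lift (mor j) (mor f) (by rintro _ ⟨t, rfl⟩; exact h t)) (by
    rw [← mor_str j, ← mor_str f]
    exact (Category.assoc _ _ _).symm.trans
      (congrArg (· ≫ X.str) (IsOpenImmersion.lift_fac (mor j) (mor f) _)))

@[simp]
lemma openLift_comp (f : T ⟶ X) (h : ∀ t, mor f t ∈ (mor j).opensRange) :
    openLift j f h ≫ j = f := mor_ext (IsOpenImmersion.lift_fac _ _ _)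

lemma isOpenImmersion_of_comp {V : KScheme k} (i : V ⟶ U) (h : IsOpenImmersion (mor (i ≫ j))) :
    IsOpenImmersion (mor i) :=
  have : IsOpenImmersion (mor i ≫ mor j) := h
  .of_comp (mor i) (mor j)

end OpenImmersion

instance {X Y : KScheme k} (f : X ⟶ Y) [IsIso f] : IsIso (mor f) :=
  ⟨mor (inv f), by rw [← mor_comp, IsIso.hom_inv_id]; rfl,
    by rw [← mor_comp, IsIso.inv_hom_id]; rfl⟩

lemma mor_map_eq {X X' Y Y' : KScheme k} (i : X ⟶ X') (j : Y ⟶ Y') :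
    mor (KScheme.map i j) = pullback.map X.str Y.str X'.str Y'.str (mor i) (mor j) (𝟙 _)
      ((Category.comp_id _).trans (mor_str i).symm)
      ((Category.comp_id _).trans (mor_str j).symm) :=
  pullback.hom_ext ((congrArg mor (map_fst i j)).trans (pullback.lift_fst _ _ _).symm)
    ((congrArg mor (map_snd i j)).trans (pullback.lift_snd _ _ _).symm)

lemma map_property (P : MorphismProperty Scheme.{u}) [P.IsStableUnderBaseChange]
    [hP : P.IsMultiplicative] {X X' Y Y' : KScheme k} (i : X ⟶ X') (j : Y ⟶ Y')
    (hi : P (mor i)) (hj : P (mor j)) : P (mor (KScheme.map i j)) := by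
  have := hP.toIsStableUnderComposition
  rw [mor_map_eq]
  exact MorphismProperty.pullbackMap hi hj (mor_str i).symm (mor_str j).symm

instance {Y Y' : KScheme k} (X : KScheme k) (j : Y ⟶ Y') [h : IsOpenImmersion (mor j)] :
    IsOpenImmersion (mor (KScheme.map (𝟙 X) j)) :=
  map_property @IsOpenImmersion (𝟙 X) j (inferInstanceAs (IsOpenImmersion (𝟙 X.toScheme))) h

lemma map_id (X Y : KScheme k) : map (𝟙 X) (𝟙 Y) = 𝟙 _ := by
  apply prod_ext <;> simp

lemma map_one_comp (X : KScheme k) {Y Y' Y'' : KScheme k} (g : Y ⟶ Y') (g' : Y' ⟶ Y'') :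
    map (𝟙 X) (g ≫ g') = map (𝟙 X) g ≫ map (𝟙 X) g' := by
  apply prod_ext <;> simp

lemma map_exchange {X X' Y Y' : KScheme k} (f : X ⟶ X') (g : Y ⟶ Y') :
    map f (𝟙 Y) ≫ map (𝟙 X') g = map (𝟙 X) g ≫ map f (𝟙 Y') := by
  apply prod_ext <;> simp

section Glue

variable {ι : Type*} {Y X : KScheme k} {U : ι → KScheme k} (g : ∀ i, U i ⟶ Y)
  [∀ i, IsOpenImmersion (mor (g i))] (hg : ∀ y, ∃ i u, mor (g i) u = y)

/-- The open cover given by a jointly surjective family of open immersions. -/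
def openCover : Y.toScheme.OpenCover :=
  .mkOfCovers ι (fun i => (U i).toScheme) (fun i => mor (g i)) hg inferInstance

include hg in
/-- Morphisms glue along jointly surjective families of open immersions. -/
lemma exists_glue (f : ∀ i, U i ⟶ X)
    (hf : ∀ (i j : ι) (T : KScheme k) (a : T ⟶ U i) (b : T ⟶ U j), a ≫ g i = b ≫ g j →
      a ≫ f i = b ≫ f j) : ∃ h : Y ⟶ X, ∀ i, g i ≫ h = f i := by
  let 𝒰 := openCover g hg
  have hc (i j : ι) : pullback.fst (mor (g i)) (mor (g j)) ≫ mor (f i) =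
      pullback.snd (mor (g i)) (mor (g j)) ≫ mor (f j) := by
    -- The compatibility hypothesis is tested on the overlap of `U i` and `U j`, made into a
    -- `k`-scheme.
    let T : KScheme k := mk (pullback.fst (mor (g i)) (mor (g j)) ≫ (U i).str)
    let a : T ⟶ U i := homMk (pullback.fst _ _) rfl
    let b : T ⟶ U j := homMk (pullback.snd (mor (g i)) (mor (g j))) (by
      rw [← mor_str (g j), ← Category.assoc, ← pullback.condition, Category.assoc, mor_str]
      rfl)
    exact congrArg mor (hf i j T a b (mor_ext pullback.condition))
  let h := 𝒰.glueMorphisms (fun i => mor (f i)) hc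
  have hh (i : ι) : mor (g i) ≫ h = mor (f i) := 𝒰.ι_glueMorphisms _ hc i
  have hs (i : ι) : mor (g i) ≫ h ≫ X.str = mor (g i) ≫ Y.str := by
    rw [← Category.assoc, hh, mor_str, mor_str]
  exact ⟨homMk h (𝒰.hom_ext _ _ hs), fun i => mor_ext (hh i)⟩

include hg in
lemma hom_ext_of_openImmersion {f f' : Y ⟶ X} (h : ∀ i, g i ≫ f = g i ≫ f') : f = f' :=
  mor_ext ((openCover g hg).hom_ext _ _ fun i => congrArg mor (h i))

end Glue

end KScheme

/-! ### The closed point of a fat point and the section it induces -/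

section Closed

variable (k) in
/-- The point `Spec k`, as a fat point. -/
def ptFat : FatPoint k := ⟨pt k, inferInstanceAs (IsFinite (𝟙 (Spec (.of k)))),
  ⟨inferInstanceAs (Unique (PrimeSpectrum k))⟩⟩

/-- The structure morphism of a `k`-scheme, to the reduced fat point. -/
def toPtFat (T : KScheme k) : T ⟶ (ptFat k).obj := toPt T

lemma toPtFat_unique {T : KScheme k} (f g : T ⟶ (ptFat k).obj) : f = g := toPt_unique f g

variable [IsAlgClosed k]

lemma length_ptFat : (ptFat k).length = 1 := by
  rw [FatPoint.length_eq_finrank]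
  let e := LinearEquiv.ofBijective (Algebra.linearMap k Γ((pt k).toScheme, ⊤))
    algebraMap_pt_bijective
  exact e.symm.finrank_eq.trans (Module.finrank_self k)

/-- The closed point of a fat point. -/
def FatPoint.point (z : FatPoint k) : ptFat k ⟶ z :=
  ⟨homMk (pointOfClosedPoint z.obj.str default (isClosed_discrete _))
    (pointOfClosedPoint_comp _ _ _)⟩

/-- Over an algebraically closed field a morphism from `Spec k` over `k` is determined by the point
it hits, and `z` has only one. -/
lemma comp_point_hom {z z' : FatPoint k} (i : z' ⟶ z) : z'.point.hom ≫ i.hom = z.point.hom := by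
  apply mor_ext
  exact ext_of_apply_closedPoint_eq z.obj.str (mor_str (z'.point.hom ≫ i.hom))
    (mor_str z.point.hom) (Subsingleton.elim _ _)

instance (z : FatPoint k) : IsClosedImmersion (mor z.point.hom) :=
  isClosedImmersion_of_comp_eq_id z.obj.str _ (mor_str z.point.hom)

/-- The section of the projection `z × T ⟶ T` given by the closed point. -/
def FatPoint.sec (z : FatPoint k) (T : KScheme k) : T ⟶ z.obj.prod T :=
  lift (toPtFat T ≫ z.point.hom) (𝟙 T)

lemma FatPoint.comp_sec (z : FatPoint k) {S T : KScheme k} (f : S ⟶ T) :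
    f ≫ z.sec T = z.sec S ≫ map (𝟙 _) f := by
  apply prod_ext
  · simp only [sec, Category.assoc, lift_fst, lift_map, Category.comp_id]
    rw [← Category.assoc, toPtFat_unique (f ≫ toPtFat T) (toPtFat S)]
  · simp [sec]

lemma FatPoint.sec_snd (z : FatPoint k) (T : KScheme k) : z.sec T ≫ snd _ _ = 𝟙 _ := lift_snd _ _

lemma FatPoint.sec_map {z z' : FatPoint k} (i : z' ⟶ z) (T : KScheme k) :
    z'.sec T ≫ map i.hom (𝟙 T) = z.sec T := by
  rw [sec, sec, lift_map, Category.comp_id, Category.assoc, comp_point_hom]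

lemma FatPoint.snd_sec_ptFat (T : KScheme k) :
    snd (ptFat k).obj T ≫ (ptFat k).sec T = 𝟙 _ := by
  apply prod_ext
  · exact toPtFat_unique _ _
  · simp [sec]

omit [IsAlgClosed k] in
lemma surjective_map {z z' : FatPoint k} (i : z' ⟶ z) (T : KScheme k) :
    Surjective (mor (map i.hom (𝟙 T))) :=
  map_property @Surjective i.hom (𝟙 T) ⟨fun _ => ⟨default, Subsingleton.elim _ _⟩⟩
    (inferInstanceAs (Surjective (𝟙 T.toScheme)))

/-- Every point of `z × T` comes from `Spec k × T`, by base change of the surjection `Spec k ⟶ z`,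
and that product is identified with `T` by its projection. -/
instance (z : FatPoint k) (T : KScheme k) : Surjective (mor (z.sec T)) := by
  refine ⟨fun x => ?_⟩
  obtain ⟨y, rfl⟩ := (surjective_map z.point T).surj x
  refine ⟨mor (snd _ _) y, ?_⟩
  have h : snd _ T ≫ z.sec T = map z.point.hom (𝟙 T) := by
    rw [← FatPoint.sec_map z.point, ← Category.assoc, FatPoint.snd_sec_ptFat, Category.id_comp]
  rw [← mor_comp_apply, h]

end Closed

/-! ### Arc schemes -/

namespace ArcScheme

section

variable {z : FatPoint k} {X : KScheme k} (A : ArcScheme z X)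

lemma map_classify {T : KScheme k} (b : z.obj.prod T ⟶ X) :
    map (𝟙 z.obj) (A.classify b) ≫ A.ev = b :=
  (Equiv.ofBijective _ (A.bijective T)).apply_symm_apply b

lemma hom_ext {T : KScheme k} {a b : T ⟶ A.carrier}
    (h : map (𝟙 z.obj) a ≫ A.ev = map (𝟙 z.obj) b ≫ A.ev) : a = b :=
  (A.bijective T).1 h

lemma classify_unique {T : KScheme k} {b : z.obj.prod T ⟶ X} {a : T ⟶ A.carrier}
    (h : map (𝟙 z.obj) a ≫ A.ev = b) : a = A.classify b :=
  A.hom_ext (h.trans (A.map_classify b).symm)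

/-- Arc schemes are functorial in the target. -/
def mapTarget {Y : KScheme k} (B : ArcScheme z Y) (f : X ⟶ Y) : A.carrier ⟶ B.carrier :=
  B.classify (A.ev ≫ f)

lemma map_mapTarget {Y : KScheme k} (B : ArcScheme z Y) (f : X ⟶ Y) :
    map (𝟙 _) (A.mapTarget B f) ≫ B.ev = A.ev ≫ f := B.map_classify _

lemma mapTarget_id (f : X ⟶ X) (hf : f = 𝟙 X) : A.mapTarget A f = 𝟙 _ :=
  A.hom_ext (by rw [map_mapTarget, hf, Category.comp_id, map_id, Category.id_comp])

lemma mapTarget_comp {Y Z : KScheme k} (B : ArcScheme z Y) (C : ArcScheme z Z) (f : X ⟶ Y)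
    (g : Y ⟶ Z) : A.mapTarget B f ≫ B.mapTarget C g = A.mapTarget C (f ≫ g) :=
  C.hom_ext (by
    rw [map_one_comp, Category.assoc, map_mapTarget, ← Category.assoc, map_mapTarget,
      Category.assoc, map_mapTarget])

/-- Arc schemes are unique up to isomorphism. -/
def uniqueIso (B : ArcScheme z X) : A.carrier ≅ B.carrier where
  hom := A.mapTarget B (𝟙 X)
  inv := B.mapTarget A (𝟙 X)
  hom_inv_id := by rw [mapTarget_comp, mapTarget_id _ _ (Category.comp_id _)]
  inv_hom_id := by rw [mapTarget_comp, mapTarget_id _ _ (Category.comp_id _)]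

lemma map_uniqueIso_hom (B : ArcScheme z X) : map (𝟙 _) (A.uniqueIso B).hom ≫ B.ev = A.ev :=
  (A.map_mapTarget B (𝟙 X)).trans (Category.comp_id _)

end

lemma map_arcMap {z z' : FatPoint k} {X : KScheme k} (i : z' ⟶ z) (A : ArcScheme z X)
    (A' : ArcScheme z' X) :
    map (𝟙 _) (arcMap i A A') ≫ A'.ev = map i.hom (𝟙 _) ≫ A.ev := A'.map_classify _

variable [IsAlgClosed k]

/-- The trivial arc scheme, along the reduced fat point. -/
def trivial (X : KScheme k) : ArcScheme (ptFat k) X where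
  carrier := X
  ev := snd _ _
  bijective T := by
    refine ⟨fun a b h => ?_, fun b => ⟨(ptFat k).sec T ≫ b, ?_⟩⟩
    · have h' : snd (ptFat k).obj T ≫ a = snd (ptFat k).obj T ≫ b := by simpa using h
      rw [← Category.id_comp a, ← Category.id_comp b, ← (ptFat k).sec_snd, Category.assoc,
        Category.assoc, h']
    · simp only [map_snd]
      rw [← Category.assoc, FatPoint.snd_sec_ptFat, Category.id_comp]

section

variable {z : FatPoint k} {X : KScheme k} (A : ArcScheme z X)

/-- The base point of an arc. -/
def base : A.carrier ⟶ X := z.sec _ ≫ A.ev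

lemma comp_base {T : KScheme k} (a : T ⟶ A.carrier) :
    a ≫ A.base = z.sec T ≫ map (𝟙 _) a ≫ A.ev := by
  rw [base, ← Category.assoc, z.comp_sec, Category.assoc]

lemma classify_base {T : KScheme k} (b : z.obj.prod T ⟶ X) :
    A.classify b ≫ A.base = z.sec T ≫ b := by
  rw [comp_base, map_classify]

lemma mapTarget_base {Y : KScheme k} (B : ArcScheme z Y) (f : X ⟶ Y) :
    A.mapTarget B f ≫ B.base = A.base ≫ f := by
  rw [mapTarget, classify_base, base, Category.assoc]

lemma arcMap_base {z' : FatPoint k} (i : z' ⟶ z) (A' : ArcScheme z' X) :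
    arcMap i A A' ≫ A'.base = A.base := by
  rw [arcMap, classify_base, ← Category.assoc, FatPoint.sec_map, base]

-- The section through the closed point is surjective, so landing in an open subset can be tested on
-- base points. This is why arc schemes localise on the target.
omit A in
lemma mem_of_sec {T : KScheme k} (b : z.obj.prod T ⟶ X) (V : X.toScheme.Opens)
    (h : ∀ t, mor (z.sec T ≫ b) t ∈ V) (s : (z.obj.prod T).toScheme) : mor b s ∈ V := by
  obtain ⟨t, rfl⟩ := (mor (z.sec T)).surjective s
  exact h t

lemma base_ev_mem (V : X.toScheme.Opens) {T : KScheme k} (a : T ⟶ A.carrier)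
    (h : ∀ t, mor a t ∈ mor A.base ⁻¹ᵁ V) (s : (z.obj.prod T).toScheme) :
    mor (map (𝟙 _) a ≫ A.ev) s ∈ V := by
  refine mem_of_sec _ V (fun t => ?_) s
  rw [← comp_base]
  exact h t

variable {U : KScheme k} (j : U ⟶ X) [IsOpenImmersion (mor j)]

/-- The arc scheme of an open subscheme is an open subscheme of the arc scheme. -/
def restrict : ArcScheme z U where
  carrier := A.carrier.opn (mor A.base ⁻¹ᵁ (mor j).opensRange)
  ev := openLift j (map (𝟙 _) (A.carrier.opnι _) ≫ A.ev)
    (A.base_ev_mem _ _ fun t => opnι_mem _ _ t)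
  bijective T := by
    have h0 (a : T ⟶ A.carrier.opn (mor A.base ⁻¹ᵁ (mor j).opensRange)) :
        (map (𝟙 _) a ≫ openLift j (map (𝟙 _) (A.carrier.opnι _) ≫ A.ev)
          (A.base_ev_mem _ _ fun t => opnι_mem _ _ t)) ≫ j =
          map (𝟙 _) (a ≫ A.carrier.opnι _) ≫ A.ev := by
      rw [Category.assoc, openLift_comp, map_one_comp, Category.assoc]
    refine ⟨fun a b h => ?_, fun b => ?_⟩
    · refine openImmersion_cancel (A.carrier.opnι _) (A.hom_ext ?_)
      rw [← h0, ← h0]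
      exact congrArg (· ≫ j) h
    -- An arc in `U`, viewed in `X`, has its base point in `U`, so its classifying map lands in the
    -- chosen open subset.
    · have hc (t : T.toScheme) : mor (A.classify (b ≫ j)) t ∈
          (mor (A.carrier.opnι (mor A.base ⁻¹ᵁ (mor j).opensRange))).opensRange := by
        rw [opensRange_opnι]
        have h := A.classify_base (b ≫ j)
        change mor (A.classify (b ≫ j) ≫ A.base) t ∈ (mor j).opensRange
        rw [h, ← Category.assoc]
        exact mem_opensRange j _
      refine ⟨openLift (A.carrier.opnι _) (A.classify (b ≫ j)) hc, openImmersion_cancel j ?_⟩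
      refine (h0 _).trans ?_
      rw [openLift_comp, map_classify]

/-- The inclusion of the arc scheme of an open subscheme. -/
def restrictι : (A.restrict j).carrier ⟶ A.carrier := A.carrier.opnι _

instance : IsOpenImmersion (mor (A.restrictι j)) :=
  inferInstanceAs (IsOpenImmersion (mor (A.carrier.opnι _)))

lemma opensRange_restrictι :
    (mor (A.restrictι j)).opensRange = mor A.base ⁻¹ᵁ (mor j).opensRange := opensRange_opnι _ _

lemma restrict_ev_comp : (A.restrict j).ev ≫ j = map (𝟙 _) (A.restrictι j) ≫ A.ev :=
  openLift_comp j _ (A.base_ev_mem _ _ fun t => opnι_mem _ _ t)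

lemma restrict_mapTarget : (A.restrict j).mapTarget A j = A.restrictι j :=
  A.hom_ext (by rw [map_mapTarget, restrict_ev_comp])

lemma mapTarget_eq_restrictι (B : ArcScheme z U) :
    B.mapTarget A j = (B.uniqueIso (A.restrict j)).hom ≫ A.restrictι j := by
  rw [← restrict_mapTarget, uniqueIso, mapTarget_comp, Category.id_comp]

instance (B : ArcScheme z U) : IsOpenImmersion (mor (B.mapTarget A j)) := by
  rw [mapTarget_eq_restrictι]
  exact inferInstanceAs (IsOpenImmersion
    (mor (B.uniqueIso (A.restrict j)).hom ≫ mor (A.restrictι j)))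

lemma opensRange_mapTarget (B : ArcScheme z U) :
    (mor (B.mapTarget A j)).opensRange = mor A.base ⁻¹ᵁ (mor j).opensRange := by
  have h : mor (B.mapTarget A j) =
      mor (B.uniqueIso (A.restrict j)).hom ≫ mor (A.restrictι j) :=
    congrArg mor (A.mapTarget_eq_restrictι j B)
  rw [← opensRange_restrictι]
  ext x
  constructor
  · rintro ⟨y, rfl⟩
    exact ⟨mor (B.uniqueIso (A.restrict j)).hom y, by rw [h]; rfl⟩
  · rintro ⟨y, rfl⟩
    refine ⟨mor (B.uniqueIso (A.restrict j)).inv y, ?_⟩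
    rw [h, ← mor_comp, ← mor_comp_apply, Iso.inv_hom_id_assoc]

/-- The map of arc schemes induced by an open immersion is the base change of the latter along
the base point. -/
lemma isPullback_mapTarget (B : ArcScheme z U) :
    IsPullback (mor B.base) (mor (B.mapTarget A j)) (mor j) (mor A.base) :=
  IsOpenImmersion.isPullback _ _ _ _ (congrArg mor (B.mapTarget_base A j))
    (A.opensRange_mapTarget j B).symm

end

/-- An arc scheme of an étale chart from one along a closed subscheme. -/
theorem exists_of_isEtaleChart {z z' : FatPoint k} (i : z' ⟶ z) [IsClosedImmersion (mor i.hom)]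
    {d : ℕ} {U : KScheme k} (hU : IsEtaleChart d U) (A' : ArcScheme z' U) :
    ∃ (A : ArcScheme z U)
      (e : A.carrier ≅ A'.carrier.prod (affineSpace k (d * (z.length - z'.length)))),
      e.hom ≫ fst _ _ = arcMap i A A' := by
  obtain ⟨b⟩ := exists_adaptedBasis i
  obtain ⟨ρ, hρ, hb⟩ := b.exists_trivialization hU
  let P := A'.carrier.prod (affineSpace k (d * (z.length - z'.length)))
  -- Yoneda: the universal arc is the one that the trivialization matches with the two projections
  -- of `P`. By naturality, `a : T ⟶ P` then corresponds to its two components (`hm`, `hs`).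
  obtain ⟨ev, hev⟩ := (hb P).2 (map (𝟙 _) (fst _ _) ≫ A'.ev, snd _ _)
  obtain ⟨h₁, h₂⟩ := Prod.ext_iff.mp hev
  simp only at h₁ h₂
  have hm {T : KScheme k} (a : T ⟶ P) : map i.hom (𝟙 T) ≫ map (𝟙 _) a ≫ ev =
      map (𝟙 _) (a ≫ fst _ _) ≫ A'.ev := by
    rw [← Category.assoc, map_exchange, Category.assoc, h₁, ← Category.assoc, ← map_one_comp]
  have hs {T : KScheme k} (a : T ⟶ P) : ρ T (map (𝟙 _) a ≫ ev) = a ≫ snd _ _ := by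
    rw [hρ, h₂]
  let A : ArcScheme z U := 
    { carrier := P
      ev := ev
      bijective := fun T => by
        refine ⟨fun a a' h => prod_ext (A'.hom_ext ?_) ?_, fun β => ?_⟩
        · rw [← hm, ← hm]
          exact congrArg _ h
        · rw [← hs, ← hs]
          exact congrArg _ h
        · refine ⟨lift (A'.classify (map i.hom (𝟙 T) ≫ β)) (ρ T β), (hb T).1 ?_⟩
          refine Prod.ext ?_ ?_
          · simp only [hm, lift_fst, map_classify]
          · simp only [hs, lift_snd] }
  exact ⟨A, Iso.refl _, (Category.id_comp _).trans (A'.classify_unique h₁.symm)⟩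

end ArcScheme

/-! ### Existence of arc schemes -/

lemma appTop_opens_ι_comp {X S : Scheme.{u}} (f : X ⟶ S) (V : X.Opens) (e : V ≤ f ⁻¹ᵁ ⊤) :
    (V.ι ≫ f).appTop = f.appLE ⊤ V e ≫ V.topIso.inv := by
  rw [Iso.eq_comp_inv, Scheme.Opens.topIso_hom, Scheme.Hom.comp_appTop]
  simp only [Scheme.Hom.appLE, Scheme.Opens.ι_appTop]
  exact (Category.assoc _ _ _).trans
    (congrArg (f.appTop ≫ ·) (X.presheaf.map_comp _ _).symm)

/-- Locally a smooth morphism is standard smooth, and a standard smooth algebra of relative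
dimension `d` is étale over a polynomial ring in `d` variables. -/
lemma exists_isEtaleChart {d : ℕ} (X : KScheme k) (hX : SmoothOfRelativeDimension d X.str)
    (x : X.toScheme) : ∃ V : X.toScheme.Opens, x ∈ V ∧ IsEtaleChart d (X.opn V) := by
  obtain ⟨U, -, V, hV, hx, e, h⟩ := hX.exists_isStandardSmoothOfRelativeDimension x
  -- The base `Spec k` is a single point, so a nonempty open subset of it is everything.
  have hU : U = ⊤ := by
    rw [eq_top_iff]
    intro y _
    have hs : Subsingleton (Spec (.of k)) := inferInstanceAs (Subsingleton (PrimeSpectrum k))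
    rw [Subsingleton.elim y (X.str x)]
    exact e hx
  subst hU
  refine ⟨V, hx, hV, ?_⟩
  have key : algebraMap k Γ((X.opn V).toScheme, ⊤) =
      (((Scheme.ΓSpecIso (.of k)).inv ≫ X.str.appLE ⊤ V e) ≫ V.topIso.inv).hom := by
    rw [algebraMap_eq]
    congr 1
    rw [Category.assoc]
    congr 1
    exact appTop_opens_ι_comp X.str V e
  have hs : (algebraMap k Γ((X.opn V).toScheme, ⊤)).IsStandardSmoothOfRelativeDimension d := by
    have hr := RingHom.isStandardSmoothOfRelativeDimension_respectsIso (n := d)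
    rw [key]
    refine (hr.cancel_right_isIso _ _).mpr ((hr.cancel_left_isIso _ _).mpr h)
  rw [RingHom.isStandardSmoothOfRelativeDimension_algebraMap] at hs
  obtain ⟨g, hg⟩ := Algebra.IsStandardSmoothOfRelativeDimension.exists_etale_mvPolynomial d k
    Γ((X.opn V).toScheme, ⊤)
  exact ⟨g, hg.formallyEtale⟩

namespace KScheme

/-- The inclusion of open subschemes. -/
def opnIncl (X : KScheme k) {V W : X.toScheme.Opens} (h : V ≤ W) : X.opn V ⟶ X.opn W :=
  openLift (X.opnι W) (X.opnι V) fun t => by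
    rw [opensRange_opnι]
    exact h (X.opnι_mem V t)

@[simp]
lemma opnIncl_comp (X : KScheme k) {V W : X.toScheme.Opens} (h : V ≤ W) :
    X.opnIncl h ≫ X.opnι W = X.opnι V := openLift_comp _ _ _

lemma opnIncl_trans (X : KScheme k) {V W W' : X.toScheme.Opens} (h : V ≤ W) (h' : W ≤ W') :
    X.opnIncl h ≫ X.opnIncl h' = X.opnIncl (h.trans h') :=
  openImmersion_cancel (X.opnι W') (by simp)

lemma opnIncl_refl (X : KScheme k) (V : X.toScheme.Opens) :
    X.opnIncl (le_refl V) = 𝟙 _ := openImmersion_cancel (X.opnι V) (by simp)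

instance (X : KScheme k) {V W : X.toScheme.Opens} (h : V ≤ W) :
    IsOpenImmersion (mor (X.opnIncl h)) :=
  isOpenImmersion_of_comp (X.opnι W) _ (by rw [opnIncl_comp]; infer_instance)

end KScheme

/-! ### Gluing schemes over an open cover of the base -/

section RelativeGluing

variable {S : Scheme.{u}} {𝒰 : S.OpenCover} [Category.{u} 𝒰.I₀] [𝒰.LocallyDirected]
  [Small.{u} 𝒰.I₀] [Quiver.IsThin 𝒰.I₀]

/-- Over the member `i` of the cover, `p` restricts to `D.natTrans.app i`; hence properties local on
the target pass from the pieces to `p`. -/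
lemma exists_glued_of_relativeGluingData (D : 𝒰.RelativeGluingData) :
    ∃ (G : Scheme.{u}) (p : G ⟶ S) (ι : ∀ i, D.functor.obj i ⟶ G)
      (_ : ∀ i, IsOpenImmersion (ι i)), (∀ i j (f : i ⟶ j), D.functor.map f ≫ ι j = ι i) ∧
      (∀ i, ι i ≫ p = D.natTrans.app i ≫ 𝒰.f i) ∧
      (∀ i, p ⁻¹ᵁ (𝒰.f i).opensRange = (ι i).opensRange) ∧
      ∀ P : MorphismProperty Scheme.{u}, IsZariskiLocalAtTarget P →
        (∀ i, P (D.natTrans.app i)) → P p := by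
  refine ⟨D.glued, D.toBase, fun i => colimit.ι D.functor i,
    fun i => D.cover.map_prop i, fun i j f => colimit.w D.functor f,
    D.ι_toBase, D.toBase_preimage_eq_opensRange_ι, fun P _ hP => ?_⟩
  rw [IsZariskiLocalAtTarget.iff_of_openCover (P := P) 𝒰]
  intro i
  have := (D.isPullback_natTrans_ι_toBase i).flip
  refine (P.cancel_left_of_respectsIso this.isoPullback.hom _).mp ?_
  have h : this.isoPullback.hom ≫ 𝒰.pullbackHom D.toBase i = D.natTrans.app i :=
    this.isoPullback_hom_snd
  rw [h]
  exact hP i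

lemma isZariskiLocalAtTarget_quasiCompact :
    IsZariskiLocalAtTarget (@QuasiCompact : MorphismProperty Scheme.{u}) :=
  @HasAffineProperty.instIsZariskiLocalAtTarget _ _
    instHasAffinePropertyQuasiCompactCompactSpaceCarrierCarrierCommRingCat.{u}

end RelativeGluing

/-! ### The glued candidate for the arc scheme -/

section Gluing

variable (z : FatPoint k) (X : KScheme k)

/-- An open subset of `X` which has an arc scheme along `z`. -/
@[ext]
structure ArcOpen : Type u where
  /-- the open subset -/
  opens : X.toScheme.Opens
  /-- the arc scheme -/
  exists_arc : Nonempty (ArcScheme z (X.opn opens))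

variable {z X}

instance : PartialOrder (ArcOpen z X) := .lift ArcOpen.opens fun _ _ => ArcOpen.ext

/-- The arc scheme of an open subset that has one. -/
def ArcOpen.arc (V : ArcOpen z X) : ArcScheme z (X.opn V.opens) := V.exists_arc.some

lemma ArcOpen.opens_le {V W : ArcOpen z X} (h : V ≤ W) : V.opens ≤ W.opens := h

/-- The maps between arc schemes of open subsets. -/
def ArcOpen.incl {V W : ArcOpen z X} (h : V ≤ W) : V.arc.carrier ⟶ W.arc.carrier :=
  V.arc.mapTarget W.arc (X.opnIncl (opens_le h))

variable [IsAlgClosed k]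

lemma ArcOpen.of_le (V : ArcOpen z X) {W : X.toScheme.Opens} (h : W ≤ V.opens) :
    Nonempty (ArcScheme z (X.opn W)) :=
  ⟨V.arc.restrict (X.opnIncl h)⟩

variable (h : ∀ x : X.toScheme, ∃ V : ArcOpen z X, x ∈ V.opens)

variable (z X) in
/-- The cover by the open subsets that have an arc scheme. -/
abbrev arcCover (h : ∀ x : X.toScheme, ∃ V : ArcOpen z X, x ∈ V.opens) : X.toScheme.OpenCover where
  I₀ := ArcOpen z X
  X V := (X.opn V.opens).toScheme
  f V := mor (X.opnι V.opens)
  mem₀ := (openCover (fun V : ArcOpen z X => X.opnι V.opens) fun x => by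
    obtain ⟨V, hV⟩ := h x
    exact ⟨V, ⟨x, hV⟩, rfl⟩).mem₀

/-- Having an arc scheme passes to smaller opens, so the opens that have one form a basis. -/
instance : (arcCover z X h).LocallyDirected :=
  Scheme.Cover.LocallyDirected.ofIsBasisOpensRange
    (fun {V W} => by
      change _ ↔ (mor (X.opnι V.opens)).opensRange ≤ (mor (X.opnι W.opens)).opensRange
      rw [opensRange_opnι, opensRange_opnι]; rfl) (by
      rw [TopologicalSpace.Opens.isBasis_iff_nbhd]
      intro U x hx
      obtain ⟨V, hV⟩ := h x
      exact ⟨V.opens ⊓ U, ⟨⟨V.opens ⊓ U, V.of_le inf_le_left⟩, opensRange_opnι X _⟩, ⟨hV, hx⟩,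
        inf_le_right⟩)

lemma trans_arcCover {V W : ArcOpen z X} (f : V ⟶ W) :
    (arcCover z X h).trans f = mor (X.opnIncl (ArcOpen.opens_le (leOfHom f))) := by
  rw [← cancel_mono (mor (X.opnι W.opens))]
  exact ((arcCover z X h).trans_map f).trans (congrArg mor (X.opnIncl_comp _)).symm

/-- The gluing datum of the arc schemes of open subsets. -/
def arcGluing : (arcCover z X h).RelativeGluingData where
  functor :=
    { obj V := V.arc.carrier.toScheme
      map f := mor (ArcOpen.incl (leOfHom f))
      map_id V := congrArg mor (V.arc.mapTarget_id _ (X.opnIncl_refl V.opens))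
      map_comp {V W W'} f g := congrArg mor ((congrArg (V.arc.mapTarget W'.arc)
        (X.opnIncl_trans _ _).symm).trans (V.arc.mapTarget_comp W.arc W'.arc _ _).symm) }
  natTrans :=
    { app V := mor V.arc.base
      naturality V W f :=
        (congrArg mor (V.arc.mapTarget_base W.arc (X.opnIncl (ArcOpen.opens_le (leOfHom f))))).trans
          (congrArg (mor V.arc.base ≫ ·) (trans_arcCover h f).symm) }
  -- The arc scheme over `V` is the preimage of `V` in the one over `W`, so the square of base point
  -- maps is cartesian.
  equifibered {V W} f := by
    have := (W.arc.isPullback_mapTarget (X.opnIncl (ArcOpen.opens_le (leOfHom f))) V.arc).flip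
    rw [← trans_arcCover h f] at this
    exact this

-- The glued scheme is again a `k`-scheme: separatedness, finite type and quasi-compactness of the
-- base point map are checked on the pieces, by cancellation from their structure morphisms.
include h in
lemma exists_glued : ∃ (G : KScheme k) (π : G ⟶ X) (ι : ∀ V : ArcOpen z X, V.arc.carrier ⟶ G)
    (_ : ∀ V, IsOpenImmersion (mor (ι V))),
    (∀ (V W : ArcOpen z X) (hVW : V ≤ W), ArcOpen.incl hVW ≫ ι W = ι V) ∧
    (∀ V, ι V ≫ π = V.arc.base ≫ X.opnι V.opens) ∧
    (∀ V, mor π ⁻¹ᵁ V.opens = (mor (ι V)).opensRange) := by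
  obtain ⟨G, p, ι, hι, hw, hp, hr, hP⟩ := exists_glued_of_relativeGluingData (arcGluing h)
  have hsep : IsSeparated p := hP _ inferInstance fun V => by
    have : IsSeparated (mor V.arc.base ≫ (X.opn V.opens).str) := by
      rw [mor_str]; infer_instance
    exact .of_comp (mor V.arc.base) (X.opn V.opens).str
  have hft : LocallyOfFiniteType p :=
    hP _ (HasRingHomProperty.instIsZariskiLocalAtTarget _) fun V => by
      have : LocallyOfFiniteType (mor V.arc.base ≫ (X.opn V.opens).str) := by
        rw [mor_str]; infer_instance
      exact locallyOfFiniteType_of_comp (mor V.arc.base) (X.opn V.opens).str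
  have hqc : QuasiCompact p := hP _ isZariskiLocalAtTarget_quasiCompact fun V => by
    have : QuasiCompact (mor V.arc.base ≫ (X.opn V.opens).str) := by
      rw [mor_str]; infer_instance
    exact .of_comp (mor V.arc.base) (X.opn V.opens).str
  let G' : KScheme k := mk (p ≫ X.str)
  let ι' (V : ArcOpen z X) : V.arc.carrier ⟶ G' := homMk (ι V)
    ((Category.assoc _ _ _).symm.trans ((congrArg (· ≫ X.str) (hp V)).trans
      (mor_str (V.arc.base ≫ X.opnι V.opens))))
  refine ⟨G', homMk p rfl, ι', hι, fun V W hVW => mor_ext (hw V W (homOfLE hVW)),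
    fun V => mor_ext (hp V), fun V => .trans ?_ (hr V)⟩
  exact congrArg _ (opensRange_opnι X V.opens).symm

end Gluing

/-! ### Existence of arc schemes and local triviality of restriction -/

section AlgClosed

variable [IsAlgClosed k]

lemma exists_map_apply_eq (z : FatPoint k) {ι : Type*} {Y : KScheme k} {U : ι → KScheme k}
    (g : ∀ i, U i ⟶ Y) (hg : ∀ y, ∃ i u, mor (g i) u = y) (y : (z.obj.prod Y).toScheme) :
    ∃ i u, mor (map (𝟙 z.obj) (g i)) u = y := by
  obtain ⟨t, rfl⟩ := (mor (z.sec Y)).surjective y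
  obtain ⟨i, u, rfl⟩ := hg t
  exact ⟨i, mor (z.sec _) u, by rw [← mor_comp_apply, ← z.comp_sec, mor_comp_apply]⟩

/-- Arc schemes exist if they exist locally. -/
theorem nonempty_arcScheme_of_cover {z : FatPoint k} {X : KScheme k}
    (h : ∀ x : X.toScheme, ∃ V : ArcOpen z X, x ∈ V.opens) : Nonempty (ArcScheme z X) := by
  obtain ⟨G, π, ι, hι, hw, hp, hr⟩ := exists_glued h
  have hsurj (g : G.toScheme) : ∃ V u, mor (ι V) u = g := by
    obtain ⟨V, hV⟩ := h (mor π g)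
    have : g ∈ (mor (ι V)).opensRange := by rw [← hr]; exact hV
    obtain ⟨u, hu⟩ := this
    exact ⟨V, u, hu⟩
  have hrange (V : ArcOpen z X) {T : KScheme k} (a : T ⟶ G) (ha : ∀ t, mor (a ≫ π) t ∈ V.opens)
      (t : T.toScheme) : mor a t ∈ (mor (ι V)).opensRange := by rw [← hr]; exact ha t
  have hev (V W : ArcOpen z X) (hVW : V ≤ W) : map (𝟙 _) (ArcOpen.incl hVW) ≫ W.arc.ev ≫
      X.opnι W.opens = V.arc.ev ≫ X.opnι V.opens := by
    rw [← Category.assoc, ArcOpen.incl, ArcScheme.map_mapTarget, Category.assoc, opnIncl_comp]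
  obtain ⟨ev, hev⟩ := exists_glue (fun V => map (𝟙 z.obj) (ι V))
    (exists_map_apply_eq z ι hsurj) (fun V => V.arc.ev ≫ X.opnι V.opens) (by
      intro V W T a b hab
      -- Where the pieces over `V` and `W` meet, base points lie in `V ⊓ W`, so both maps factor
      -- through the arc scheme of `M`, on which the two universal arcs agree.
      let M : ArcOpen z X := ⟨V.opens ⊓ W.opens, V.of_le inf_le_left⟩
      have hMV : M ≤ V := inf_le_left (a := V.opens)
      have hMW : M ≤ W := inf_le_right (a := V.opens)
      have h₁ : a ≫ fst _ _ = b ≫ fst _ _ := by simpa using congrArg (· ≫ fst _ _) hab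
      have h₂ : (a ≫ snd _ _) ≫ ι V = (b ≫ snd _ _) ≫ ι W := by
        simpa using congrArg (· ≫ snd _ _) hab
      have hm (t : T.toScheme) : mor (((a ≫ snd _ _) ≫ ι V) ≫ π) t ∈ M.opens := by
        refine ⟨?_, ?_⟩
        · rw [Category.assoc, hp, ← Category.assoc]
          exact opnι_mem _ _ _
        · rw [h₂, Category.assoc, hp, ← Category.assoc]
          exact opnι_mem _ _ _
      let c := openLift (ι M) _ (hrange M _ hm)
      have hc : c ≫ ι M = (a ≫ snd _ _) ≫ ι V := openLift_comp _ _ _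
      have hcV : c ≫ ArcOpen.incl hMV = a ≫ snd _ _ :=
        openImmersion_cancel (ι V) (by rw [Category.assoc, hw, hc])
      have hcW : c ≫ ArcOpen.incl hMW = b ≫ snd _ _ :=
        openImmersion_cancel (ι W) (by rw [Category.assoc, hw, hc, h₂])
      have ha : a = lift (a ≫ fst _ _) c ≫ map (𝟙 _) (ArcOpen.incl hMV) := by
        apply prod_ext <;> simp [hcV]
      have hb : b = lift (a ≫ fst _ _) c ≫ map (𝟙 _) (ArcOpen.incl hMW) := by
        apply prod_ext <;> simp [hcW, h₁]
      rw [ha, hb, Category.assoc, Category.assoc, hev, hev])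
  have hπ : z.sec G ≫ ev = π := hom_ext_of_openImmersion ι hsurj fun V => by
    rw [← Category.assoc, z.comp_sec, Category.assoc, hev, hp, ArcScheme.base, Category.assoc]
  have hbase {T : KScheme k} (a : T ⟶ G) : a ≫ π = z.sec T ≫ map (𝟙 _) a ≫ ev := by
    rw [← hπ, ← Category.assoc, z.comp_sec, Category.assoc]
  have hlocal {T : KScheme k} (f : T ⟶ X) (t : T.toScheme) : ∃ (V : ArcOpen z X)
      (u : (T.opn (mor f ⁻¹ᵁ V.opens)).toScheme), mor (T.opnι _) u = t := by
    obtain ⟨V, hV⟩ := h (mor f t)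
    exact ⟨V, ⟨t, hV⟩, rfl⟩
  have hinj (T : KScheme k) (a b : T ⟶ G) (hab : map (𝟙 _) a ≫ ev = map (𝟙 _) b ≫ ev) :
      a = b := by
    -- Equal arcs have equal base points. Over the preimage of each `V` both maps therefore factor
    -- through the arc scheme of `V`, where uniqueness is known.
    have hab' : a ≫ π = b ≫ π := by rw [hbase, hbase, hab]
    refine hom_ext_of_openImmersion _ (hlocal (a ≫ π)) fun V => ?_
    let j := T.opnι (mor (a ≫ π) ⁻¹ᵁ V.opens)
    have hj (t) : mor (j ≫ a ≫ π) t ∈ V.opens := opnι_mem T (mor (a ≫ π) ⁻¹ᵁ V.opens) t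
    have hlift (c : T ⟶ G) (hc : c ≫ π = a ≫ π) : ∃ c', c' ≫ ι V = j ≫ c :=
      ⟨openLift (ι V) (j ≫ c) (hrange V _ (by rw [Category.assoc, hc]; exact hj)),
        openLift_comp _ _ _⟩
    obtain ⟨a', ha'⟩ := hlift a rfl
    obtain ⟨b', hb'⟩ := hlift b hab'.symm
    have hev' (c : T.opn (mor (a ≫ π) ⁻¹ᵁ V.opens) ⟶ V.arc.carrier) :
        (map (𝟙 _) c ≫ V.arc.ev) ≫ X.opnι V.opens = map (𝟙 _) (c ≫ ι V) ≫ ev := by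
      rw [Category.assoc, ← hev, ← Category.assoc, ← map_one_comp]
    have : a' = b' := V.arc.hom_ext (openImmersion_cancel (X.opnι V.opens) (by
      rw [hev', hev', ha', hb', map_one_comp, map_one_comp, Category.assoc, Category.assoc, hab]))
    change j ≫ a = j ≫ b
    rw [← ha', ← hb', this]
  refine ⟨G, ev, fun T => ⟨fun a b hab => hinj T a b hab, fun β => ?_⟩⟩
  -- Over the preimage of `V` under the base point map `f`, the whole family `β` lies in `V` and can
  -- be classified there; `hinj` makes the local classifying maps agree on overlaps.
  let f := z.sec T ≫ β
  let j (V : ArcOpen z X) := T.opnι (mor f ⁻¹ᵁ V.opens)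
  have hj (V : ArcOpen z X) (s) : mor (map (𝟙 z.obj) (j V) ≫ β) s ∈
      (mor (X.opnι V.opens)).opensRange := by
    rw [opensRange_opnι]
    refine ArcScheme.mem_of_sec _ _ (fun t => ?_) s
    rw [← Category.assoc, ← z.comp_sec, Category.assoc]
    exact opnι_mem T (mor f ⁻¹ᵁ V.opens) t
  have hc' (V : ArcOpen z X) : ∃ c : T.opn (mor f ⁻¹ᵁ V.opens) ⟶ G,
      map (𝟙 _) c ≫ ev = map (𝟙 _) (j V) ≫ β :=
    ⟨V.arc.classify (openLift (X.opnι V.opens) _ (hj V)) ≫ ι V, by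
      rw [map_one_comp, Category.assoc, hev, ← Category.assoc, ArcScheme.map_classify,
        openLift_comp]⟩
  choose c hc using hc'
  obtain ⟨a, ha⟩ := exists_glue j (hlocal f) c fun V W S p q hpq => hinj S _ _ (by
    rw [map_one_comp, map_one_comp, Category.assoc, Category.assoc, hc, hc, ← Category.assoc,
      ← Category.assoc, ← map_one_comp, ← map_one_comp, hpq])
  refine ⟨a, hom_ext_of_openImmersion _ (exists_map_apply_eq z j (hlocal f)) fun V => ?_⟩
  change map (𝟙 z.obj) (j V) ≫ map (𝟙 _) a ≫ ev = _
  rw [← hc, ← Category.assoc, ← map_one_comp, ha]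

/-- Smooth schemes have arc schemes. -/
theorem nonempty_arcScheme_of_smooth (z : FatPoint k) {d : ℕ} (X : KScheme k)
    (hX : SmoothOfRelativeDimension d X.str) : Nonempty (ArcScheme z X) :=
  nonempty_arcScheme_of_cover fun x => by
    obtain ⟨V, hx, hV⟩ := exists_isEtaleChart X hX x
    -- The closed point is a closed subscheme of `z` for which the arc scheme is known: it is the
    -- chart itself.
    obtain ⟨A, -⟩ := ArcScheme.exists_of_isEtaleChart z.point hV (ArcScheme.trivial _)
    exact ⟨⟨V, ⟨A⟩⟩, hx⟩

namespace ArcScheme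

/-- Over an étale chart, restriction of arcs to a closed subscheme is a projection. -/
lemma exists_iso_prod_of_isEtaleChart {z z' : FatPoint k} (i : z' ⟶ z)
    [IsClosedImmersion (mor i.hom)] {d : ℕ} {U : KScheme k} (hU : IsEtaleChart d U)
    (A : ArcScheme z U) (A' : ArcScheme z' U) :
    ∃ e : A.carrier ≅ A'.carrier.prod (affineSpace k (d * (z.length - z'.length))),
      e.hom ≫ fst _ _ = arcMap i A A' := by
  obtain ⟨B, e, he⟩ := exists_of_isEtaleChart i hU A'
  refine ⟨A.uniqueIso B ≪≫ e, ?_⟩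
  rw [Iso.trans_hom, Category.assoc, he]
  refine A'.hom_ext ?_
  rw [map_one_comp, Category.assoc, map_arcMap, map_arcMap, ← Category.assoc, ← map_exchange,
    Category.assoc, map_uniqueIso_hom]

lemma restrictι_arcMap {z z' : FatPoint k} {X U : KScheme k} (i : z' ⟶ z) (A : ArcScheme z X)
    (A' : ArcScheme z' X) (j : U ⟶ X) [IsOpenImmersion (mor j)] :
    A.restrictι j ≫ arcMap i A A' =
      arcMap i (A.restrict j) (A'.restrict j) ≫ A'.restrictι j := by
  refine A'.hom_ext ?_
  rw [map_one_comp, Category.assoc, map_arcMap, map_one_comp, Category.assoc, ← restrict_ev_comp,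
    ← Category.assoc, ← Category.assoc, map_arcMap, ← map_exchange, Category.assoc,
    Category.assoc, restrict_ev_comp]

end ArcScheme

/-- A morphism is trivial with fiber `F` over an open subset. -/
def IsTrivialOver {Y X : KScheme k} (f : Y ⟶ X) (F : KScheme k) (U : X.toScheme.Opens) : Prop :=
  ∃ e : Y.opn (mor f ⁻¹ᵁ U) ≅ (X.opn U).prod F,
    e.hom ≫ fst _ _ ≫ X.opnι U = Y.opnι _ ≫ f

/-- The neighborhood is the preimage of an étale chart of `X` under the base point map. Restriction
of arcs preserves base points, so over it the map is the restriction map for the chart, which is a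
projection. -/
theorem exists_isTrivialOver_arcMap {z z' : FatPoint k} (i : z' ⟶ z)
    [IsClosedImmersion (mor i.hom)] {d : ℕ} {X : KScheme k}
    (hX : SmoothOfRelativeDimension d X.str) (A : ArcScheme z X) (A' : ArcScheme z' X)
    (a : A'.carrier.toScheme) : ∃ U : A'.carrier.toScheme.Opens, a ∈ U ∧
      IsTrivialOver (arcMap i A A') (affineSpace k (d * (z.length - z'.length))) U := by
  obtain ⟨V, hV, hVc⟩ := exists_isEtaleChart X hX (mor A'.base a)
  obtain ⟨e, he⟩ := ArcScheme.exists_iso_prod_of_isEtaleChart i hVc (A.restrict (X.opnι V))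
    (A'.restrict (X.opnι V))
  refine ⟨mor A'.base ⁻¹ᵁ (mor (X.opnι V)).opensRange, by rw [opensRange_opnι]; exact hV, ?_⟩
  have hpre : mor (arcMap i A A') ⁻¹ᵁ mor A'.base ⁻¹ᵁ (mor (X.opnι V)).opensRange =
      mor A.base ⁻¹ᵁ (mor (X.opnι V)).opensRange := by
    rw [← A.arcMap_base i A']
    rfl
  rw [IsTrivialOver, hpre]
  refine ⟨e, ?_⟩
  have := A.restrictι_arcMap i A' (X.opnι V)
  rw [← he, Category.assoc] at this
  exact this.symm

omit [IsAlgClosed k] in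
theorem isLocallyTrivialFibration_of_isTrivialOver {Y X F : KScheme k} (f : Y ⟶ X)
    (h : ∀ x, ∃ U, x ∈ U ∧ IsTrivialOver f F U) : IsLocallyTrivialFibration f F := by
  intro x
  obtain ⟨U, hx, e, he⟩ := h x
  refine ⟨U, hx, ⟨mor e.hom, mor e.inv, congrArg mor e.hom_inv_id, congrArg mor e.inv_hom_id⟩, ?_⟩
  rw [← cancel_mono U.ι, morphismRestrict_ι]
  exact (Category.assoc _ _ _).trans (congrArg mor he)

theorem isLocallyTrivialFibration_arcMap {z z' : FatPoint k} (i : z' ⟶ z)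
    [IsClosedImmersion (mor i.hom)] {d : ℕ} {X : KScheme k}
    (hX : SmoothOfRelativeDimension d X.str) (A : ArcScheme z X) (A' : ArcScheme z' X) :
    IsLocallyTrivialFibration (arcMap i A A')
      (affineSpace k (d * (z.length - z'.length))) :=
  isLocallyTrivialFibration_of_isTrivialOver _ (exists_isTrivialOver_arcMap i hX A A')

end AlgClosed

/-! ### Classes in the Grothendieck ring -/

namespace Sieve

lemma mem_image_iff {X U : KScheme k} (j : U ⟶ X) [IsOpenImmersion (mor j)] {w : FatPoint k}
    (p : w.obj ⟶ X) : p ∈ (image j).points w ↔ ∀ t, mor p t ∈ (mor j).opensRange := by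
  constructor
  · rintro ⟨q, rfl⟩ t
    exact mem_opensRange j _
  · exact fun h => ⟨openLift j p h, openLift_comp _ _ _⟩

lemma isSubZariski_image {X Y : KScheme k} (φ : Y ⟶ X) : (image φ).IsSubZariski := ⟨Y, φ, rfl⟩

/-- The image of an open immersion is explicitly isomorphic to its source. -/
lemma isomorphic_image (S : Site) {X U : KScheme k} (j : U ⟶ X) [IsOpenImmersion (mor j)] :
    Isomorphic S (all U) (image j) := by
  let t : Mor (image j) (all U) :=
    { app w p := ⟨p.2.choose, trivial⟩
      naturality {v w} f p := openImmersion_cancel j (by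
        have h₁ := p.2.choose_spec
        have h₂ := ((image j).comp_mem f p.2).choose_spec
        rw [Category.assoc, h₁]
        exact h₂) }
  have ht (w) (p : (image j).points w) : (t.app w p).1 ≫ j = p.1 := p.2.choose_spec
  -- The inverse, although defined by choice, is explicit: it is induced by `𝟙 U`, with `U` as the
  -- locally closed subscheme of `X`.
  refine ⟨Mor.ofHom j fun w p _ => ⟨p, rfl⟩, t, fun w p => Subtype.ext ?_, fun w p =>
    Subtype.ext (ht w p), fun _ => ⟨Mor.isExplicit_ofHom _ _, U, j, 𝟙 U, inferInstance,
      fun w => subset_rfl, fun w q hq => ?_⟩⟩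
  · exact openImmersion_cancel j (ht w _)
  · exact openImmersion_cancel j ((ht w _).trans (by simp))

/-- Here it matters that the test objects are fat points: with a single point, a map into `V ⊔ W`
already lands in `V` or in `W`. -/
lemma image_opnι_union {X : KScheme k} (V W : X.toScheme.Opens) :
    (image (X.opnι V)).union (image (X.opnι W)) = image (X.opnι (V ⊔ W)) := by
  ext w p
  change p ∈ (image (X.opnι V)).points w ∨ p ∈ (image (X.opnι W)).points w ↔ _
  rw [mem_image_iff, mem_image_iff, mem_image_iff, opensRange_opnι, opensRange_opnι,
    opensRange_opnι, Unique.forall_iff, Unique.forall_iff, Unique.forall_iff]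
  rfl

lemma image_opnι_inter {X : KScheme k} (V W : X.toScheme.Opens) :
    (image (X.opnι V)).inter (image (X.opnι W)) = image (X.opnι (V ⊓ W)) := by
  ext w p
  change p ∈ (image (X.opnι V)).points w ∧ p ∈ (image (X.opnι W)).points w ↔ _
  rw [mem_image_iff, mem_image_iff, mem_image_iff, opensRange_opnι, opensRange_opnι,
    opensRange_opnι, Unique.forall_iff, Unique.forall_iff, Unique.forall_iff]
  rfl

lemma image_opnι_top (X : KScheme k) : image (X.opnι ⊤) = all X := by
  ext w p
  rw [mem_image_iff, opensRange_opnι]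
  exact ⟨fun _ => trivial, fun _ _ => trivial⟩

end Sieve

/-- The class of a motif in the Grothendieck ring. -/
def motifClass (S : Site) (M : Motif k) : GrothendieckRing k S :=
  Ideal.Quotient.mk (Ideal.span (scissorRelations k S)) (symbol S M)

lemma motifClass_eq {S : Site} {M N : Motif k} (h : M.Isomorphic S N) :
    motifClass S M = motifClass S N := by
  rw [motifClass, motifClass, symbol, symbol, Quot.sound h]

lemma motifClass_prod (S : Site) (M N : Motif k) :
    motifClass S (M.prod N) = motifClass S M * motifClass S N := by
  have h : symbol S (M.prod N) = symbol S M * symbol S N :=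
    (MonoidAlgebra.of ℤ (MotifClass k S)).map_mul (Quot.mk _ M) (Quot.mk _ N)
  exact (congrArg (Ideal.Quotient.mk (Ideal.span (scissorRelations k S))) h).trans
    (map_mul (Ideal.Quotient.mk (Ideal.span (scissorRelations k S))) _ _)

variable (k) in
lemma schemeClass_pt (S : Site) : schemeClass S (pt k) = 1 := by
  have h : symbol S (Motif.ofScheme (pt k)) = 1 :=
    (MonoidAlgebra.of ℤ (MotifClass k S)).map_one
  exact (congrArg (Ideal.Quotient.mk (Ideal.span (scissorRelations k S))) h).trans
    (map_one (Ideal.Quotient.mk (Ideal.span (scissorRelations k S))))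

lemma schemeClass_eq_of_iso (S : Site) {X Y : KScheme k} (e : X ≅ Y) :
    schemeClass S X = schemeClass S Y :=
  motifClass_eq (M := .ofScheme X) (N := .ofScheme Y) (Sieve.Isomorphic.of_ambient e.hom e.inv
    e.hom_inv_id e.inv_hom_id (fun _ _ _ => trivial) (fun _ _ _ => trivial))

lemma schemeClass_prod (S : Site) (X Y : KScheme k) :
    schemeClass S (X.prod Y) = schemeClass S X * schemeClass S Y := by
  refine .trans ?_ (motifClass_prod S (.ofScheme X) (.ofScheme Y))
  exact motifClass_eq (M := .ofScheme (X.prod Y)) (Sieve.Isomorphic.of_ambient (𝟙 _) (𝟙 _)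
    (Category.comp_id _) (Category.comp_id _) (fun _ _ _ => ⟨trivial, trivial⟩)
    (fun _ _ _ => trivial))

lemma schemeClass_eq_image (S : Site) {X U : KScheme k} (j : U ⟶ X) [IsOpenImmersion (mor j)] :
    schemeClass S U = motifClass S ⟨X, _, Sieve.isSubZariski_image j⟩ :=
  motifClass_eq (M := .ofScheme U) (Sieve.isomorphic_image S j)

lemma schemeClass_opn_top (S : Site) (X : KScheme k) :
    schemeClass S (X.opn ⊤) = schemeClass S X := by
  rw [schemeClass_eq_image S (X.opnι ⊤)]
  congr 1
  simp only [Sieve.image_opnι_top, Motif.ofScheme]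

lemma schemeClass_opn_sup_add_inf (S : Site) (X : KScheme k) (V W : X.toScheme.Opens) :
    schemeClass S (X.opn (V ⊔ W)) + schemeClass S (X.opn (V ⊓ W)) =
      schemeClass S (X.opn V) + schemeClass S (X.opn W) := by
  rw [schemeClass_eq_image S (X.opnι (V ⊔ W)), schemeClass_eq_image S (X.opnι (V ⊓ W)),
    schemeClass_eq_image S (X.opnι V), schemeClass_eq_image S (X.opnι W)]
  have hU : ((Sieve.image (X.opnι V)).union (Sieve.image (X.opnι W))).IsSubZariski := by
    rw [Sieve.image_opnι_union]; exact Sieve.isSubZariski_image _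
  have hI : ((Sieve.image (X.opnι V)).inter (Sieve.image (X.opnι W))).IsSubZariski := by
    rw [Sieve.image_opnι_inter]; exact Sieve.isSubZariski_image _
  have h := (Ideal.Quotient.eq_zero_iff_mem (I := Ideal.span (scissorRelations k S))).mpr
    (Ideal.subset_span ⟨X, _, _, Sieve.isSubZariski_image (X.opnι V),
      Sieve.isSubZariski_image (X.opnι W), hU, hI, rfl⟩)
  rw [map_sub, map_sub, map_add, sub_sub, sub_eq_zero] at h
  simp only [Sieve.image_opnι_union, Sieve.image_opnι_inter] at h
  exact h.symm

/-! ### Locally trivial fibrations in the Grothendieck ring -/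

section Fibration

variable {Y X F : KScheme k} (f : Y ⟶ X)

lemma IsTrivialOver.mono {V W : X.toScheme.Opens} (h : V ≤ W) (hW : IsTrivialOver f F W) :
    IsTrivialOver f F V := by
  obtain ⟨e, he⟩ := hW
  have hi : mor f ⁻¹ᵁ V ≤ mor f ⁻¹ᵁ W := fun _ hx => h hx
  let a : Y.opn (mor f ⁻¹ᵁ V) ⟶ X.opn V := openLift (X.opnι V) (Y.opnι _ ≫ f) fun t => by
    rw [opensRange_opnι]
    exact opnι_mem Y (mor f ⁻¹ᵁ V) t
  have ha : a ≫ X.opnι V = Y.opnι _ ≫ f := openLift_comp _ _ _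
  have he' : e.inv ≫ Y.opnι _ ≫ f = fst _ _ ≫ X.opnι W := by
    rw [← he, Iso.inv_hom_id_assoc]
  have hb' : (map (X.opnIncl h) (𝟙 F) ≫ e.inv ≫ Y.opnι _) ≫ f = fst _ _ ≫ X.opnι V := by
    rw [Category.assoc, Category.assoc, he', map_fst_assoc, opnIncl_comp]
  let b : (X.opn V).prod F ⟶ Y.opn (mor f ⁻¹ᵁ V) :=
    openLift (Y.opnι _) (map (X.opnIncl h) (𝟙 F) ≫ e.inv ≫ Y.opnι _) fun t => by
      rw [opensRange_opnι]
      change mor (_ ≫ f) t ∈ V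
      rw [hb', mor_comp_apply]
      exact opnι_mem _ _ _
  have hb : b ≫ Y.opnι _ = map (X.opnIncl h) (𝟙 F) ≫ e.inv ≫ Y.opnι _ := openLift_comp _ _ _
  have hbi : b ≫ Y.opnIncl hi = map (X.opnIncl h) (𝟙 F) ≫ e.inv :=
    openImmersion_cancel (Y.opnι _) (by rw [Category.assoc, opnIncl_comp, hb, Category.assoc])
  have hae : lift a (Y.opnIncl hi ≫ e.hom ≫ snd _ _) ≫ map (X.opnIncl h) (𝟙 F) =
      Y.opnIncl hi ≫ e.hom := by
    rw [lift_map]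
    apply prod_ext
    · refine openImmersion_cancel (X.opnι W) ?_
      rw [lift_fst, Category.assoc, opnIncl_comp, ha, Category.assoc, Category.assoc, he,
        ← Category.assoc, opnIncl_comp]
    · simp
  refine ⟨⟨lift a (Y.opnIncl hi ≫ e.hom ≫ snd _ _), b, ?_, ?_⟩, ?_⟩
  · refine openImmersion_cancel (Y.opnι _) ?_
    rw [Category.assoc, hb, ← Category.assoc, hae, Category.assoc, Iso.hom_inv_id_assoc,
      opnIncl_comp, Category.id_comp]
  · apply prod_ext
    · refine openImmersion_cancel (X.opnι V) ?_
      simp only [Category.assoc, lift_fst_assoc, Category.id_comp]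
      rw [ha, ← Category.assoc, hb, hb']
    · rw [Category.assoc, lift_snd, ← Category.assoc, hbi, Category.assoc,
        Iso.inv_hom_id_assoc, map_snd, Category.comp_id, Category.id_comp]
  · rw [lift_fst_assoc, ha]

lemma IsTrivialOver.bot : IsTrivialOver f F ⊥ := by
  have hX : IsEmpty (X.opn ⊥).toScheme := ⟨fun t => (X.opnι_mem ⊥ t).elim⟩
  have hY : IsEmpty (Y.opn (mor f ⁻¹ᵁ ⊥)).toScheme :=
    ⟨fun t => (Y.opnι_mem (mor f ⁻¹ᵁ ⊥) t).elim⟩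
  have hP : IsEmpty ((X.opn ⊥).prod F).toScheme := ⟨fun t => hX.elim (mor (fst _ _) t)⟩
  have iY := isInitialOfIsEmpty (X := (Y.opn (mor f ⁻¹ᵁ ⊥)).toScheme)
  have iP := isInitialOfIsEmpty (X := ((X.opn ⊥).prod F).toScheme)
  exact ⟨⟨homMk (iY.to _) (iY.hom_ext _ _), homMk (iP.to _) (iP.hom_ext _ _),
    mor_ext (iY.hom_ext _ _), mor_ext (iP.hom_ext _ _)⟩, mor_ext (iY.hom_ext _ _)⟩

variable {f}

lemma IsTrivialOver.schemeClass_eq (S : Site) {V : X.toScheme.Opens} (h : IsTrivialOver f F V) :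
    schemeClass S (Y.opn (mor f ⁻¹ᵁ V)) = schemeClass S (X.opn V) * schemeClass S F := by
  obtain ⟨e, -⟩ := h
  rw [schemeClass_eq_of_iso S e, schemeClass_prod]

/-- Mayer–Vietoris upstairs and downstairs carries the product formula from two opens to their
union; finitely many trivialising opens cover `X`. -/
theorem schemeClass_eq_mul_of_isTrivialOver (S : Site)
    (h : ∀ x, ∃ U, x ∈ U ∧ IsTrivialOver f F U) :
    schemeClass S Y = schemeClass S X * schemeClass S F := by
  -- Quantifying over all smaller opens makes the formula available on intersections, which the
  -- union step needs in `h₅`.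
  let good (V : X.toScheme.Opens) : Prop := ∀ W ≤ V,
    schemeClass S (Y.opn (mor f ⁻¹ᵁ W)) = schemeClass S (X.opn W) * schemeClass S F
  have htriv (V) (hV : IsTrivialOver f F V) : good V := fun W hW =>
    (hV.mono f hW).schemeClass_eq S
  have hsup (V V') (hV : good V) (hV' : good V') : good (V ⊔ V') := fun W hW => by
    have e : W = (W ⊓ V) ⊔ (W ⊓ V') := by rw [← inf_sup_left, inf_eq_left.mpr hW]
    have h₁ := schemeClass_opn_sup_add_inf S X (W ⊓ V) (W ⊓ V')
    have h₂ := schemeClass_opn_sup_add_inf S Y (mor f ⁻¹ᵁ (W ⊓ V)) (mor f ⁻¹ᵁ (W ⊓ V'))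
    have h₃ := hV (W ⊓ V) inf_le_right
    have h₄ := hV' (W ⊓ V') inf_le_right
    have h₅ := hV ((W ⊓ V) ⊓ (W ⊓ V')) (inf_le_left.trans inf_le_right)
    have h₂' : schemeClass S (Y.opn (mor f ⁻¹ᵁ ((W ⊓ V) ⊔ (W ⊓ V')))) +
        schemeClass S (Y.opn (mor f ⁻¹ᵁ ((W ⊓ V) ⊓ (W ⊓ V')))) =
        schemeClass S (Y.opn (mor f ⁻¹ᵁ (W ⊓ V))) +
        schemeClass S (Y.opn (mor f ⁻¹ᵁ (W ⊓ V'))) := h₂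
    rw [← e] at h₁ h₂'
    linear_combination h₂' - h₅ + h₃ + h₄ - schemeClass S F * h₁
  obtain ⟨V, hV, hVt⟩ : ∃ V, good V ∧ (Set.univ : Set X.toScheme) ⊆ V := by
    refine isCompact_univ.induction_on (p := fun s => ∃ V, good V ∧ s ⊆ (V : Set X.toScheme))
      ⟨⊥, htriv _ (.bot f), Set.empty_subset _⟩ ?_ ?_ ?_
    · rintro s t hst ⟨V, hV, ht⟩
      exact ⟨V, hV, hst.trans ht⟩
    · rintro s t ⟨V, hV, hs⟩ ⟨W, hW, ht⟩
      exact ⟨V ⊔ W, hsup V W hV hW, Set.union_subset_union hs ht⟩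
    · intro x _
      obtain ⟨U, hx, hU⟩ := h x
      exact ⟨U, mem_nhdsWithin_of_mem_nhds (U.isOpen.mem_nhds hx), U, htriv U hU, subset_rfl⟩
  have := hV ⊤ fun x _ => hVt trivial
  rw [schemeClass_opn_top] at this
  rw [← this]
  exact (schemeClass_opn_top S Y).symm

end Fibration

/-! ### Classes of affine spaces -/

section AffineSpace

lemma exists_coords_eq {X : KScheme k} {n : ℕ} (v : Fin n → Γ(X.toScheme, ⊤)) :
    ∃ f : X ⟶ affineSpace k n, ∀ i, coords f i = v i := by
  obtain ⟨f, hf⟩ := (coords_bijective X n).2 v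
  exact ⟨f, congrFun hf⟩

lemma coords_ext {X : KScheme k} {n : ℕ} {f g : X ⟶ affineSpace k n}
    (h : ∀ i, coords f i = coords g i) : f = g :=
  (coords_bijective X n).1 (funext h)

variable (k)

lemma nonempty_affineSpace_zero_iso : Nonempty (affineSpace k 0 ≅ pt k) := by
  obtain ⟨f, -⟩ := exists_coords_eq (X := pt k) (n := 0) Fin.elim0
  exact ⟨⟨toPt _, f, coords_ext fun i => i.elim0, toPt_unique _ _⟩⟩

lemma nonempty_affineSpace_succ_iso (n : ℕ) :
    Nonempty (affineSpace k (n + 1) ≅ (affineSpace k n).prod (affineSpace k 1)) := by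
  obtain ⟨a, ha⟩ := exists_coords_eq fun i : Fin n => coords (𝟙 (affineSpace k (n + 1))) i.castSucc
  obtain ⟨b, hb⟩ := exists_coords_eq fun _ : Fin 1 =>
    coords (𝟙 (affineSpace k (n + 1))) (Fin.last n)
  obtain ⟨c, hc⟩ := exists_coords_eq (n := n + 1) (Fin.snoc
    (α := fun _ => Γ(((affineSpace k n).prod (affineSpace k 1)).toScheme, ⊤))
    (coords (fst (affineSpace k n) (affineSpace k 1)))
    (coords (snd (affineSpace k n) (affineSpace k 1)) 0))
  have hca : c ≫ a = fst _ _ := coords_ext fun i => by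
    rw [coords_comp, ha, ← coords_comp, Category.comp_id, hc, Fin.snoc_castSucc]
  have hcb : c ≫ b = snd _ _ := coords_ext fun i => by
    rw [coords_comp, hb, ← coords_comp, Category.comp_id, hc, Fin.snoc_last, Subsingleton.elim i 0]
  refine ⟨⟨lift a b, c, coords_ext fun i => ?_, ?_⟩⟩
  · rw [coords_comp, hc]
    refine Fin.lastCases ?_ (fun i => ?_) i
    · rw [Fin.snoc_last, ← coords_comp, lift_snd, hb]
    · rw [Fin.snoc_castSucc, ← coords_comp, lift_fst, ha]
  · apply prod_ext
    · rw [Category.assoc, lift_fst, hca, Category.id_comp]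
    · rw [Category.assoc, lift_snd, hcb, Category.id_comp]

theorem schemeClass_affineSpace (S : Site) (n : ℕ) :
    schemeClass S (affineSpace k n) = lefschetz k S ^ n := by
  induction n with
  | zero =>
    obtain ⟨e⟩ := nonempty_affineSpace_zero_iso k
    rw [schemeClass_eq_of_iso S e, schemeClass_pt, pow_zero]
  | succ n ih =>
    obtain ⟨e⟩ := nonempty_affineSpace_succ_iso k n
    rw [schemeClass_eq_of_iso S e, schemeClass_prod, ih, pow_succ, lefschetz]

end AffineSpace

/-- Restriction to the closed point, whose length is one, is a locally trivial map onto the trivial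
arc scheme `X`; this is the source of `z.length - 1`. -/
theorem schemeClass_arcScheme [IsAlgClosed k] (S : Site) (z : FatPoint k) {d : ℕ} {X : KScheme k}
    (hX : SmoothOfRelativeDimension d X.str) (A : ArcScheme z X) :
    schemeClass S A.carrier = schemeClass S X * lefschetz k S ^ (d * (z.length - 1)) := by
  rw [← schemeClass_affineSpace, ← length_ptFat (k := k)]
  exact schemeClass_eq_mul_of_isTrivialOver S
    (exists_isTrivialOver_arcMap z.point hX A (ArcScheme.trivial X))

end FatArc

end

theorem theoremT (k : Type u) [Field k] [IsAlgClosed k] (d : ℕ) (X : FatArc.KScheme k)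
    (hX : SmoothOfRelativeDimension d X.str) :
    (∀ z : FatArc.FatPoint k, Nonempty (FatArc.ArcScheme z X)) ∧
    (∀ (z z' : FatArc.FatPoint k) (i : z' ⟶ z), IsClosedImmersion (FatArc.KScheme.mor i.hom) →
      ∀ (A : FatArc.ArcScheme z X) (A' : FatArc.ArcScheme z' X),
        FatArc.IsLocallyTrivialFibration (FatArc.arcMap i A A')
          (FatArc.KScheme.affineSpace k (d * (z.length - z'.length)))) ∧
    (∀ (z : FatArc.FatPoint k) (A : FatArc.ArcScheme z X) (S : FatArc.Site),
      FatArc.schemeClass S A.carrier =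
        FatArc.schemeClass S X * FatArc.lefschetz k S ^ (d * (z.length - 1))) := by
  exact ⟨fun z => FatArc.nonempty_arcScheme_of_smooth z X hX,
    fun z z' i _ A A' => FatArc.isLocallyTrivialFibration_arcMap i hX A A',
    fun z A S => FatArc.schemeClass_arcScheme S z hX A⟩
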